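/- Let $\mathcal H$ be an infinite-dimensional separable real Hilbert space (for instance $L^2[0,1]$), and for $a,b\in\mathcal H$ write $a\otimes b$ for the operator $v\mapsto\langle a,v\rangle b$. Let $x_t,y_t,z_t,u_t$ ($t\ge 1$) be $\mathcal H$-valued random variables on a probability space, $\mathcal A$ a bounded linear operator on $\mathcal H$, $\mathcal C_{xz}=\mathbb E[x_t\otimes z_t]$, $\widehat{\mathcal C}_{xz}=T^{-1}\sum_{t=1}^T x_t\otimes z_t$, and similarly for other pairs of processes. Let $\mathfrak F_{t}=\sigma(\{z_s\}_{1\le s\le t+1},\{u_s\}_{1\le s\le t})$. Assume the following. (1) $y_t=\mathcal A x_t+u_t$, with $\mathbb E[x_t]=\mathbb E[z_t]=\mathbb E[u_t]=0$ and $\mathbb E[x_t\otimes u_t]\ne0$. (2) $\{(x_t,z_t)\}_{t\ge1}$ is strictly stationary and strongly ($\alpha$-)mixing with geometrically decaying mixing coefficients, $\mathbb E\|x_t\|^2<\infty$ and $\mathbb E\|z_t\|^2<\infty$. (3) $\mathbb E[u_t\mid\mathfrak F_{t-1}]=0$, $\mathbb E[u_t\otimes u_t\mid\mathfrak F_{t-1}]=\mathcal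 C_{uu}$, and for some $\delta>0$, $\mathbb E\|u_t\|^{2+\delta}<\infty$ for all $t$ and $\sup_t\mathbb E[\|u_t\|^{2+\delta}\mid\mathfrak F_{t-1}]<\infty$ a.s. (4) $\ker\mathcal C_{xz}^*\mathcal C_{xz}=\{0\}$, $\mathcal A$ is Hilbert–Schmidt, and the eigenvalues of $\mathcal C_{xz}^*\mathcal C_{xz}$ satisfy $\lambda_1^2>\lambda_2^2>\dots>0$. (5) In Hilbert–Schmidt norm, $\|\widehat{\mathcal C}_{xz}-\mathcal C_{xz}\|$, $\|\widehat{\mathcal C}_{zz}-\mathcal C_{zz}\|$ and $\|\widehat{\mathcal C}_{uz}-\mathcal C_{uz}\|$ are $O_p(T^{-1/2})$, and $\|\widehat{\mathcal C}_{uu}-\mathcal C_{uu}\|=o_p(1)$. (6) For some constants $m_x,m_z,m_u$, almost surely $\sup_t\|x_t\|\le m_x$, $\sup_t\|z_t\|\le m_z$ and $\sup_t\|u_t\|\le m_u$. (7) The eigenvalues $\Lambda_1\ge\Lambda_2\ge\dots$ (with multiplicity) of the covariance operator of $x_t\otimes z_t$, regarded as a random element of the Hilbert space of Hilbert–Schmidt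 operators on $\mathcal H$, satisfy $\Lambda_j\le ab^j$ for all $j$, for some $a>0$ and $0<b<1$. Let $\hat\lambda_1^2\ge\hat\lambda_2^2\ge\dots\ge0$ and $\hat f_1,\hat f_2,\dots$ be the eigenvalues (with multiplicity) of $\widehat{\mathcal C}_{xz}^*\widehat{\mathcal C}_{xz}$ and any corresponding orthonormal eigenvectors. For $\alpha>0$ put $\mathrm K=\#\{j:\hat\lambda_j^2>\alpha\}$ and $$\widehat{\mathcal A}=\widehat{\mathcal C}_{yz}^*\widehat{\mathcal C}_{xz}\sum_{j=1}^{\mathrm K}\hat\lambda_j^{-2}\,\hat f_j\otimes\hat f_j,\qquad \tau(\alpha)=\sum_{j=1}^{\mathrm K}\tau_j,$$ where $\tau_j=2\sqrt2\max\{(\lambda_{j-1}^2-\lambda_j^2)^{-1},(\lambda_j^2-\lambda_{j+1}^2)^{-1}\}$ for $j\ge2$ and $\tau_1=2\sqrt2(\lambda_1^2-\lambda_2^2)^{-1}$. Let $\alpha=\alpha_T>0$ be deterministic with $\alpha_T\to0$ as $T\to\infty$. If $\tau(\alpha_T)=o(T^{1/2}\log^{-3/2}T)$ almost surely and $\alpha_T^{-1}T^{-1}\log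 T\to0$, then $\|\widehat{\mathcal A}-\mathcal A\|_{\mathrm{op}}\to0$ almost surely as $T\to\infty$. -/

import Mathlib

open MeasureTheory Filter Topology Asymptotics
open scoped InnerProductSpace

namespace FIVE

noncomputable section

section HilbertSchmidtSpace

variable (H : Type*) [NormedAddCommGroup H] [InnerProductSpace ℝ H] [CompleteSpace H]

/-- Index set of a fixed orthonormal basis of `H`. -/
def basisIndex : Set H := (exists_hilbertBasis ℝ H).choose

/-- A fixed orthonormal (Hilbert) basis of `H`. -/
def stdBasis : HilbertBasis (basisIndex H) ℝ H := (exists_hilbertBasis ℝ H).choose_spec.choose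

variable {H}

/-- `T` is Hilbert-Schmidt: `∑ ‖T e_i‖ ^ 2 < ∞` for an orthonormal basis `(e_i)`
(the sum does not depend on the basis). -/
def IsHilbertSchmidt (T : H →L[ℝ] H) : Prop := Summable fun i => ‖T (stdBasis H i)‖ ^ 2

lemma isHilbertSchmidt_iff (T : H →L[ℝ] H) :
    IsHilbertSchmidt T ↔ Memℓp (fun i => T (stdBasis H i)) 2 := by
  rw [memℓp_gen_iff (by norm_num)]
  simp [IsHilbertSchmidt]

variable (H)

/-- The linear space of Hilbert-Schmidt operators. -/
def hsSubmodule : Submodule ℝ (H →L[ℝ] H) where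
  carrier := {T | IsHilbertSchmidt T}
  add_mem' {S T} hS hT := by
    simp only [Set.mem_ofPred_eq, isHilbertSchmidt_iff] at *
    exact hS.add hT
  zero_mem' := by simp [IsHilbertSchmidt, summable_zero]
  smul_mem' c T hT := by
    simp only [Set.mem_ofPred_eq, isHilbertSchmidt_iff] at *
    exact hT.const_smul c

/-- The type of Hilbert-Schmidt operators on `H`. It is a type of its own because it carries the
Hilbert-Schmidt inner product and norm, not the operator norm. -/
def HilbertSchmidt : Type _ := ↥(hsSubmodule H)

variable {H}

/-- The underlying bounded operator. -/
def HilbertSchmidt.toCLM (T : HilbertSchmidt H) : H →L[ℝ] H := T.1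

instance : AddCommGroup (HilbertSchmidt H) := inferInstanceAs (AddCommGroup ↥(hsSubmodule H))

instance : Module ℝ (HilbertSchmidt H) := inferInstanceAs (Module ℝ ↥(hsSubmodule H))

/-- The images of the basis vectors, as a square-summable family. -/
def HilbertSchmidt.toL2 : HilbertSchmidt H →ₗ[ℝ] lp (fun _ : basisIndex H => H) 2 where
  toFun T := ⟨fun i => T.toCLM (stdBasis H i), (isHilbertSchmidt_iff _).1 T.2⟩
  map_add' _ _ := rfl
  map_smul' _ _ := rfl

lemma HilbertSchmidt.toL2_injective : Function.Injective (HilbertSchmidt.toL2 (H := H)) := by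
  intro S T h
  apply Subtype.ext
  refine ContinuousLinearMap.ext_on (s := Set.range (stdBasis H)) ?_ ?_
  · have := (stdBasis H).dense_span
    exact (Submodule.dense_iff_topologicalClosure_eq_top).2 this
  · rintro _ ⟨i, rfl⟩
    exact congrFun (congrArg Subtype.val h) i

/-- The Hilbert-Schmidt norm `‖T‖ = (∑ ‖T e_i‖ ^ 2) ^ (1 / 2)`. -/
instance : NormedAddCommGroup (HilbertSchmidt H) :=
  NormedAddCommGroup.induced _ _ HilbertSchmidt.toL2 HilbertSchmidt.toL2_injective

/-- The Hilbert-Schmidt inner product `⟪S, T⟫ = ∑ ⟪S e_i, T e_i⟫`. -/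
instance : InnerProductSpace ℝ (HilbertSchmidt H) where
  norm_smul_le c T := by
    change ‖HilbertSchmidt.toL2 (c • T)‖ ≤ ‖c‖ * ‖HilbertSchmidt.toL2 T‖
    rw [map_smul, norm_smul]
  inner S T := ⟪HilbertSchmidt.toL2 S, HilbertSchmidt.toL2 T⟫_ℝ
  norm_sq_eq_re_inner T := norm_sq_eq_re_inner (𝕜 := ℝ) (HilbertSchmidt.toL2 T)
  conj_inner_symm S T :=
    inner_conj_symm (𝕜 := ℝ) (HilbertSchmidt.toL2 S) (HilbertSchmidt.toL2 T)
  add_left S T R := by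
    simp only [map_add, inner_add_left]
  smul_left S T c := by
    simp only [map_smul, inner_smul_left]

lemma HilbertSchmidt.toL2_surjective : Function.Surjective (HilbertSchmidt.toL2 (H := H)) := by
  intro v
  have hv : Summable fun i => ‖v i‖ ^ 2 := by
    have := (memℓp_gen_iff (p := 2) (by norm_num)).1 v.2
    simpa using this
  have key (x : H) : Summable (fun i => ‖⟪stdBasis H i, x⟫_ℝ • v i‖) ∧
      ∑' i, ‖⟪stdBasis H i, x⟫_ℝ • v i‖ ≤ ‖v‖ * ‖x‖ := by
    have hx : HasSum (fun i => ‖⟪stdBasis H i, x⟫_ℝ‖ ^ (2 : ℝ)) (‖x‖ ^ (2 : ℝ)) := by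
      have h := lp.hasSum_norm (p := 2) (by norm_num) ((stdBasis H).repr x)
      simpa [HilbertBasis.repr_apply_apply] using h
    have hv' : HasSum (fun i => ‖v i‖ ^ (2 : ℝ)) (‖v‖ ^ (2 : ℝ)) := by
      have h := lp.hasSum_norm (p := 2) (by norm_num) v
      simpa using h
    have hpq : (2 : ℝ).HolderConjugate 2 := by
      constructor <;> norm_num
    obtain ⟨C, hC0, hC, hsum⟩ := Real.inner_le_Lp_mul_Lq_hasSum_of_nonneg hpq
      (norm_nonneg v) (norm_nonneg x) (fun i => norm_nonneg _) (fun i => norm_nonneg _) hv' hx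
    have hs : HasSum (fun i => ‖⟪stdBasis H i, x⟫_ℝ • v i‖) C := by
      simpa only [norm_smul, mul_comm] using hsum
    exact ⟨hs.summable, hs.tsum_eq.le.trans hC⟩
  let T₀ : H →ₗ[ℝ] H :=
    { toFun := fun x => ∑' i, ⟪stdBasis H i, x⟫_ℝ • v i
      map_add' := fun x y => by
        rw [← ((key x).1.of_norm).tsum_add ((key y).1.of_norm)]
        simp only [inner_add_right, add_smul]
      map_smul' := fun c x => by
        rw [RingHom.id_apply, ← ((key x).1.of_norm).tsum_const_smul c]
        simp only [inner_smul_right, mul_smul] }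
  let T : H →L[ℝ] H := T₀.mkContinuous ‖v‖ fun x =>
    (norm_tsum_le_tsum_norm (key x).1).trans (key x).2
  have hT (i : basisIndex H) : T (stdBasis H i) = v i := by
    change ∑' j, ⟪stdBasis H j, stdBasis H i⟫_ℝ • v j = v i
    rw [tsum_eq_single i]
    · rw [real_inner_self_eq_norm_sq, (stdBasis H).orthonormal.1 i]
      simp
    · intro j hj
      rw [(stdBasis H).orthonormal.2 hj, zero_smul]
  refine ⟨⟨T, ?_⟩, ?_⟩
  · change Summable fun i => ‖T (stdBasis H i)‖ ^ 2
    simpa only [hT] using hv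
  · apply Subtype.ext
    funext i
    exact hT i

instance : CompleteSpace (HilbertSchmidt H) := by
  have hiso : Isometry (HilbertSchmidt.toL2 (H := H)) :=
    AddMonoidHomClass.isometry_of_norm _ fun _ => rfl
  refine (completeSpace_congr (e := Equiv.ofBijective _
    ⟨HilbertSchmidt.toL2_injective, HilbertSchmidt.toL2_surjective⟩) ?_).2 inferInstance
  exact hiso.isUniformEmbedding

end HilbertSchmidtSpace

section Operators

variable {E F : Type*} [NormedAddCommGroup E] [InnerProductSpace ℝ E]
  [NormedAddCommGroup F] [InnerProductSpace ℝ F]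

/-- The tensor product `a ⊗ b`, that is, the operator `v ↦ ⟪a, v⟫ b`. -/
def tensor (a : E) (b : F) : E →L[ℝ] F := InnerProductSpace.rankOne ℝ b a

/-- `C = ∑ j, lam j • (e j ⊗ e j)` with orthonormal `e` and `lam 0 ≥ lam 1 ≥ … ≥ 0`: the spectral
decomposition of a nonnegative self-adjoint compact operator on an infinite-dimensional space. The
positive terms of `lam` are the positive eigenvalues in decreasing order with multiplicity. -/
structure SpectralDecomposition (C : E →L[ℝ] E) (lam : ℕ → ℝ) (e : ℕ → E) : Prop where
  orthonormal : Orthonormal ℝ e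
  antitone : Antitone lam
  nonneg : ∀ j, 0 ≤ lam j
  hasSum : ∀ v, HasSum (fun j => lam j • tensor (e j) (e j) v) (C v)

variable {H : Type*} [NormedAddCommGroup H] [InnerProductSpace ℝ H] [CompleteSpace H]

lemma isHilbertSchmidt_tensor (a b : H) : IsHilbertSchmidt (tensor a b) := by
  have h := (memℓp_gen_iff (p := 2) (by norm_num)).1 ((stdBasis H).repr a).2
  have h2 : Summable fun i => ‖⟪stdBasis H i, a⟫_ℝ‖ ^ 2 := by
    simpa [HilbertBasis.repr_apply_apply] using h
  refine (h2.mul_right (‖b‖ ^ 2)).congr fun i => ?_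
  simp [tensor, norm_smul, mul_pow, real_inner_comm]

/-- `a ⊗ b` as an element of the Hilbert space of Hilbert-Schmidt operators. -/
def tensorHS (a b : H) : HilbertSchmidt H := ⟨tensor a b, isHilbertSchmidt_tensor a b⟩

end Operators

section Moments

variable {Ω : Type*} [MeasurableSpace Ω] (μ : Measure Ω)
variable {E F : Type*} [NormedAddCommGroup E] [InnerProductSpace ℝ E]
  [NormedAddCommGroup F] [InnerProductSpace ℝ F]

/-- `E[X ⊗ Y]`. -/
def crossMoment (X : Ω → E) (Y : Ω → F) : E →L[ℝ] F := ∫ ω, tensor (X ω) (Y ω) ∂μ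

/-- The covariance operator `E[(X - E X) ⊗ (X - E X)]`. -/
def covOp (X : Ω → E) : E →L[ℝ] E :=
  crossMoment μ (fun ω => X ω - ∫ η, X η ∂μ) (fun ω => X ω - ∫ η, X η ∂μ)

variable {H : Type*} [NormedAddCommGroup H] [InnerProductSpace ℝ H] [CompleteSpace H]

/-- `E[X ⊗ Y]` as a Hilbert-Schmidt operator. -/
def crossMomentHS (X Y : Ω → H) : HilbertSchmidt H := ∫ ω, tensorHS (X ω) (Y ω) ∂μ

end Moments

section Processes

variable {Ω : Type*} [MeasurableSpace Ω] (μ : Measure Ω)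

/-- Strict stationarity: the law of the process, on the space of trajectories, is invariant under
time shifts. -/
def StrictlyStationary {S : Type*} [MeasurableSpace S] (w : ℕ → Ω → S) : Prop :=
  ∀ h : ℕ, μ.map (fun ω t => w (t + h) ω) = μ.map (fun ω t => w t ω)

/-- Strong (alpha-) mixing at a geometric rate: the mixing coefficients
`sup |P(A ∩ B) - P(A) P(B)|`, over `A` in the past up to time `n` and `B` in the future from time
`n + k` on, are at most `c r ^ k` for some `r < 1`. -/
def GeometricallyStronglyMixing {S : Type*} [MeasurableSpace S] (w : ℕ → Ω → S) : Prop :=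
  ∃ c r : ℝ, 0 < r ∧ r < 1 ∧ ∀ k n : ℕ, 1 ≤ k → ∀ A B : Set Ω,
    MeasurableSet[⨆ s ≤ n, MeasurableSpace.comap (w s) inferInstance] A →
    MeasurableSet[⨆ s ≥ n + k, MeasurableSpace.comap (w s) inferInstance] B →
    |μ.real (A ∩ B) - μ.real A * μ.real B| ≤ c * r ^ k

/-- `X T = O_p(r T)` as `T → ∞`. -/
def IsBigOInProbability {S : Type*} [Norm S] (X : ℕ → Ω → S) (r : ℕ → ℝ) : Prop :=
  ∀ ε : ℝ, 0 < ε → ∃ M : ℝ, ∀ᶠ T in atTop, μ {ω | M * r T < ‖X T ω‖} ≤ ENNReal.ofReal ε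

/-- The sigma-algebra generated by the instruments up to and including time `t` and the errors
strictly before time `t`. -/
abbrev pastSigma {S : Type*} [MeasurableSpace S] (z u : ℕ → Ω → S) (t : ℕ) : MeasurableSpace Ω :=
  (⨆ s ≤ t, MeasurableSpace.comap (z s) inferInstance) ⊔
    (⨆ s < t, MeasurableSpace.comap (u s) inferInstance)

end Processes

section Estimator

variable {Ω : Type*}
variable {H : Type*} [NormedAddCommGroup H] [InnerProductSpace ℝ H] [CompleteSpace H]

/-- The sample cross-moment `T⁻¹ ∑ X_t ⊗ Y_t` over the first `T` observations. Processes are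
indexed from `0`, so that the observation times are `0, …, T - 1`. -/
def sampleMoment (X Y : ℕ → Ω → H) (T : ℕ) (ω : Ω) : H →L[ℝ] H :=
  (T : ℝ)⁻¹ • ∑ t ∈ Finset.range T, tensor (X t ω) (Y t ω)

/-- The sample cross-moment as a Hilbert-Schmidt operator. -/
def sampleMomentHS (X Y : ℕ → Ω → H) (T : ℕ) (ω : Ω) : HilbertSchmidt H :=
  (T : ℝ)⁻¹ • ∑ t ∈ Finset.range T, tensorHS (X t ω) (Y t ω)

/-- The number `K` of eigenvalues (with multiplicity) that exceed the threshold `α`. -/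
def numRetained (ev : ℕ → ℝ) (α : ℝ) : ℕ := {j | α < ev j}.ncard

/-- The rank-regularized inverse `∑ j < K, (ev j)⁻¹ • (e j ⊗ e j)`. -/
def regInverse (ev : ℕ → ℝ) (e : ℕ → H) (K : ℕ) : H →L[ℝ] H :=
  ∑ j ∈ Finset.range K, (ev j)⁻¹ • tensor (e j) (e j)

/-- The functional IV estimator computed from the first `T` observations, with threshold `α`, where
`(ev, e)` are the eigenvalues and eigenfunctions of `Ĉ_xz* Ĉ_xz`. -/
def estimator (x y z : ℕ → Ω → H) (T : ℕ) (ω : Ω) (ev : ℕ → ℝ) (e : ℕ → H) (α : ℝ) :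
    H →L[ℝ] H :=
  (sampleMoment y z T ω).adjoint ∘L sampleMoment x z T ω ∘L regInverse ev e (numRetained ev α)

/-- `2 √2` times the larger of the reciprocals of the gaps between the eigenvalue of index `j` and
its neighbours. The first eigenvalue has only one neighbour. -/
def gapWeight (lam : ℕ → ℝ) : ℕ → ℝ
  | 0 => 2 * √2 * (lam 0 - lam 1)⁻¹
  | j + 1 => 2 * √2 * max (lam j - lam (j + 1))⁻¹ (lam (j + 1) - lam (j + 2))⁻¹

end Estimator

section Assumptions

variable {Ω : Type*} [MeasurableSpace Ω] (μ : Measure Ω)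
variable {H : Type*} [NormedAddCommGroup H] [InnerProductSpace ℝ H] [CompleteSpace H]
  [MeasurableSpace H]

/-- The functional endogenous linear model and the conditions on it. All processes are indexed
from `0`. Here `lam j` is the eigenvalue number `j + 1` of `C_xz* C_xz` (a squared singular value
of `C_xz`) and `f j` is its eigenfunction. -/
structure ModelAssumption (A : H →L[ℝ] H) (x y z u : ℕ → Ω → H) (lam : ℕ → ℝ) (f : ℕ → H) :
    Prop where
  measurable_x : ∀ t, Measurable (x t)
  measurable_y : ∀ t, Measurable (y t)
  measurable_z : ∀ t, Measurable (z t)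
  measurable_u : ∀ t, Measurable (u t)
  /-- the model equation -/
  model : ∀ t, ∀ᵐ ω ∂μ, y t ω = A (x t ω) + u t ω
  endogenous : ∀ t, crossMoment μ (x t) (u t) ≠ 0
  mean_x : ∀ t, ∫ ω, x t ω ∂μ = 0
  mean_z : ∀ t, ∫ ω, z t ω ∂μ = 0
  mean_u : ∀ t, ∫ ω, u t ω ∂μ = 0
  /-- dependence and moments of regressor and instrument -/
  stationary : StrictlyStationary μ fun t ω => (x t ω, z t ω)
  mixing : GeometricallyStronglyMixing μ fun t ω => (x t ω, z t ω)
  sq_integrable_x : ∀ t, MemLp (x t) 2 μ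
  sq_integrable_z : ∀ t, MemLp (z t) 2 μ
  /-- the errors are homoscedastic martingale differences, with a higher conditional moment -/
  martingale_diff : ∀ t, μ[u t | pastSigma z u t] =ᵐ[μ] 0
  homoscedastic : ∀ t, μ[fun ω => tensor (u t ω) (u t ω) | pastSigma z u t] =ᵐ[μ]
    fun _ => crossMoment μ (u 0) (u 0)
  cond_moment : ∃ δ : ℝ, 0 < δ ∧ (∀ t, Integrable (fun ω => ‖u t ω‖ ^ (2 + δ)) μ) ∧
    ∀ᵐ ω ∂μ, BddAbove (Set.range fun t => (μ[fun η => ‖u t η‖ ^ (2 + δ) | pastSigma z u t]) ω)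
  /-- identification: `C_xz* C_xz` is injective -/
  identified : ∀ v, (crossMoment μ (x 0) (z 0)).adjoint (crossMoment μ (x 0) (z 0) v) = 0 → v = 0
  hilbertSchmidt : IsHilbertSchmidt A
  /-- the eigenvalues of `C_xz* C_xz` are positive and distinct -/
  spectral : SpectralDecomposition
    ((crossMoment μ (x 0) (z 0)).adjoint ∘L crossMoment μ (x 0) (z 0)) lam f
  strictAnti : StrictAnti lam
  pos : ∀ j, 0 < lam j
  /-- behaviour of sample moments -/
  sample_xz : IsBigOInProbability μ
    (fun T ω => sampleMomentHS x z T ω - crossMomentHS μ (x 0) (z 0)) (fun T => (√(T : ℝ))⁻¹)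
  sample_zz : IsBigOInProbability μ
    (fun T ω => sampleMomentHS z z T ω - crossMomentHS μ (z 0) (z 0)) (fun T => (√(T : ℝ))⁻¹)
  sample_uz : IsBigOInProbability μ
    (fun T ω => sampleMomentHS u z T ω - crossMomentHS μ (u 0) (z 0)) (fun T => (√(T : ℝ))⁻¹)
  sample_uu : TendstoInMeasure μ (sampleMomentHS u u) atTop fun _ => crossMomentHS μ (u 0) (u 0)

/-- The additional conditions: almost sure bounds, and geometric decay of the eigenvalues
`Λ 0 ≥ Λ 1 ≥ …` of the covariance operator of `x_t ⊗ z_t`, which by stationarity does not depend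
on `t`, in the Hilbert space of Hilbert-Schmidt operators. -/
structure StrongAssumption (x z u : ℕ → Ω → H) : Prop where
  bounded_x : ∃ m : ℝ, ∀ᵐ ω ∂μ, ∀ t, ‖x t ω‖ ≤ m
  bounded_z : ∃ m : ℝ, ∀ᵐ ω ∂μ, ∀ t, ‖z t ω‖ ≤ m
  bounded_u : ∃ m : ℝ, ∀ᵐ ω ∂μ, ∀ t, ‖u t ω‖ ≤ m
  eigenvalue_decay : ∃ (Λ : ℕ → ℝ) (e : ℕ → HilbertSchmidt H),
    SpectralDecomposition (covOp μ fun ω => tensorHS (x 0 ω) (z 0 ω)) Λ e ∧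
    ∃ a b : ℝ, 0 < a ∧ 0 < b ∧ b < 1 ∧ ∀ j, Λ j ≤ a * b ^ (j + 1)

end Assumptions

end

end FIVE

/-! Let `R` be the regularized inverse and `P` the orthogonal projection onto the `K` retained
empirical eigenvectors, so that `Ĉ_xz* Ĉ_xz R = P`. Substituting `y = A x + u` gives `Â - A = Ĉ_uz*
Ĉ_xz R - A (1 - P)`, a noise term minus a bias term.

Noise. By the spectral theorem `‖Ĉ_xz R‖ ≤ α^(-1/2)`. The summands `u_t ⊗ z_t` are bounded
martingale differences in the Hilbert space of Hilbert-Schmidt operators, so an Azuma inequality in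
Hilbert space and Borel-Cantelli give `‖Ĉ_uz‖ = O(√(log T / T))` almost surely
(`ae_eventually_norm_sum_le`). The product is `O(√(log T / (α T)))`, which tends to zero.

Bias. Individual eigenvectors need not be followed. For a population eigenvector, `lam i • (1 - P)
f_i = (1 - P) C f_i`; replacing `C = C_xz* C_xz` by its sample version costs the norm of the
difference, and the sample version has norm at most `α` off the range of `P`. Hence `1 - P → 0` on
every `f_i`, and then strongly, because the `f_i` span a dense subspace by injectivity of `C`. Being
Hilbert-Schmidt, `A` turns strong convergence into norm convergence
(`tendsto_norm_comp_sub_spectralProj`).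

The bias argument needs `Ĉ_xz → C_xz` almost surely. This is a strong law for bounded functions of a
stationary, geometrically mixing process, proved first for indicators and extended by approximation
(`ae_tendsto_average_of_bounded`). -/

namespace FIVE

/-! ### An Azuma inequality in Hilbert space. -/

section HilbertAzuma

variable {E : Type*} [NormedAddCommGroup E] [InnerProductSpace ℝ E]

/-- Convexity of `w ↦ cosh √w` bounds `cosh ‖S + d‖` by an affine function of `⟪S, d⟫`. -/
lemma cosh_norm_add_le (S d : E) {c : ℝ} (hc : 0 < c) (hd : ‖d‖ ≤ c) :
    Real.cosh ‖S + d‖ ≤ Real.cosh ‖S‖ * Real.cosh c +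
      ⟪S, d⟫_ℝ * (Real.sinh ‖S‖ * Real.sinh c / (‖S‖ * c)) := by
  rcases eq_or_ne S 0 with rfl | hS
  · have h : Real.cosh ‖d‖ ≤ Real.cosh c := by rwa [Real.cosh_le_cosh, abs_norm, abs_of_pos hc]
    simpa using h
  have hs : 0 < ‖S‖ := norm_pos_iff.2 hS
  set s := ‖S‖ with hs_def
  -- The inner product is `θ s c` with `θ ∈ [-1, 1]`, so `‖S + d‖ ^ 2` is at most the average of `(s
  -- - c) ^ 2` and `(s + c) ^ 2` with weights `(1 - θ) / 2` and `(1 + θ) / 2`.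
  set θ : ℝ := ⟪S, d⟫_ℝ / (s * c) with hθ
  have hin : ⟪S, d⟫_ℝ = θ * (s * c) := by rw [hθ]; field_simp
  have habs : |⟪S, d⟫_ℝ| ≤ s * c :=
    (abs_real_inner_le_norm S d).trans (mul_le_mul_of_nonneg_left hd hs.le)
  have hθ1 : |θ| ≤ 1 := by
    rw [hθ, abs_div, abs_of_pos (mul_pos hs hc)]
    exact div_le_one_of_le₀ habs (by positivity)
  obtain ⟨h1, h2⟩ := abs_le.1 hθ1
  have hsq : ‖S + d‖ ^ 2 ≤ (1 - θ) / 2 * (s - c) ^ 2 + (1 + θ) / 2 * (s + c) ^ 2 := by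
    rw [norm_add_sq_real, hin]
    nlinarith [norm_nonneg d]
  -- Convexity of `cosh √w` is used coefficientwise: each `w ^ k` is convex on `[0, ∞)`. The
  -- addition formulas then collapse the average to `cosh s cosh c + θ sinh s sinh c`.
  have hterm (k : ℕ) : ‖S + d‖ ^ (2 * k) / ((2 * k).factorial : ℝ) ≤
      (1 - θ) / 2 * ((s - c) ^ (2 * k) / ((2 * k).factorial : ℝ)) +
      (1 + θ) / 2 * ((s + c) ^ (2 * k) / ((2 * k).factorial : ℝ)) := by
    obtain ⟨-, hpow⟩ := convexOn_pow (𝕜 := ℝ) k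
    have hconv := hpow (Set.mem_Ici.2 (sq_nonneg (s - c))) (Set.mem_Ici.2 (sq_nonneg (s + c)))
      (by linarith : 0 ≤ (1 - θ) / 2) (by linarith : 0 ≤ (1 + θ) / 2) (by ring)
    simp only [smul_eq_mul] at hconv
    have := (pow_le_pow_left₀ (sq_nonneg ‖S + d‖) hsq k).trans hconv
    simp only [← pow_mul] at this
    calc _ ≤ ((1 - θ) / 2 * (s - c) ^ (2 * k) + (1 + θ) / 2 * (s + c) ^ (2 * k)) /
          ((2 * k).factorial : ℝ) := by gcongr
      _ = _ := by ring
  have h := hasSum_le hterm (Real.hasSum_cosh ‖S + d‖)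
    (((Real.hasSum_cosh (s - c)).mul_left _).add ((Real.hasSum_cosh (s + c)).mul_left _))
  refine h.trans_eq ?_
  rw [Real.cosh_add, Real.cosh_sub, hin]
  field_simp
  ring

variable {Ω : Type*} {mΩ : MeasurableSpace Ω} {μ : Measure Ω} [IsProbabilityMeasure μ]

/-- `W` pulls out of the conditional expectation. Only the product is assumed integrable: in the
application `W` contains an arbitrary measurable function of the past. -/
lemma integral_inner_eq_zero_of_condExp_eq_zero {m : MeasurableSpace Ω} [CompleteSpace E]
    {u W : Ω → E} (hm : m ≤ mΩ) (hu : Integrable u μ) (hW : StronglyMeasurable[m] W)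
    (huW : Integrable (fun ω => ⟪W ω, u ω⟫_ℝ) μ) (h0 : μ[u | m] =ᵐ[μ] 0) :
    ∫ ω, ⟪W ω, u ω⟫_ℝ ∂μ = 0 := by
  have h := condExp_bilin_of_stronglyMeasurable_left (μ := μ) (m := m) (innerSL ℝ) hW huW hu
  change μ[fun ω => ⟪W ω, u ω⟫_ℝ | m] =ᵐ[μ] fun ω => ⟪W ω, (μ[u | m]) ω⟫_ℝ at h
  rw [← integral_condExp hm, integral_congr_ae h, ← integral_zero Ω ℝ (μ := μ)]
  refine integral_congr_ae ?_
  filter_upwards [h0] with ω hω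
  simp [hω]

/-- An exponential tail bound for sums of bounded Hilbert space valued increments satisfying the
orthogonality relation of martingale differences. -/
lemma measure_norm_sum_ge_le {d : ℕ → Ω → E} (hd : ∀ t, AEStronglyMeasurable (d t) μ) {c : ℝ}
    (hc : 0 < c) (hdc : ∀ t, ∀ᵐ ω ∂μ, ‖d t ω‖ ≤ c)
    (horth : ∀ t, ∀ ψ : ℝ → ℝ, Measurable ψ →
      Integrable (fun ω => ⟪∑ s ∈ Finset.range t, d s ω, d t ω⟫_ℝ *
        ψ ‖∑ s ∈ Finset.range t, d s ω‖) μ →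
      ∫ ω, ⟪∑ s ∈ Finset.range t, d s ω, d t ω⟫_ℝ * ψ ‖∑ s ∈ Finset.range t, d s ω‖ ∂μ = 0)
    {l : ℝ} (hl : 0 < l) (n : ℕ) (r : ℝ) :
    μ.real {ω | r ≤ ‖∑ s ∈ Finset.range n, d s ω‖} ≤
      2 * Real.exp (n * (l * c) ^ 2 / 2 - l * r) := by
  set S : ℕ → Ω → E := fun n ω => ∑ s ∈ Finset.range n, d s ω with hS
  have hSm (n : ℕ) : AEStronglyMeasurable (S n) μ :=
    Finset.aestronglyMeasurable_fun_sum _ fun s _ => hd s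
  have hSb (n : ℕ) : ∀ᵐ ω ∂μ, ‖S n ω‖ ≤ n * c := by
    filter_upwards [ae_all_iff.2 hdc] with ω hω
    refine (norm_sum_le_of_le _ fun s _ => hω s).trans ?_
    simp
  have hcm (n : ℕ) : AEStronglyMeasurable (fun ω => Real.cosh (l * ‖S n ω‖)) μ :=
    Real.continuous_cosh.comp_aestronglyMeasurable ((hSm n).norm.const_mul l)
  have hci (n : ℕ) : Integrable (fun ω => Real.cosh (l * ‖S n ω‖)) μ := by
    refine Integrable.of_bound (hcm n) (Real.cosh (l * (n * c))) ?_
    filter_upwards [hSb n] with ω hω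
    rw [Real.norm_of_nonneg (Real.cosh_pos _).le, Real.cosh_le_cosh,
      abs_of_nonneg (by positivity), abs_of_nonneg (by positivity)]
    gcongr
  -- Each increment multiplies the expectation of `cosh (l ‖S‖)` by at most `cosh (l c)`, because
  -- the term linear in the increment integrates to zero by `horth`.
  have hstep (n : ℕ) : ∫ ω, Real.cosh (l * ‖S n ω‖) ∂μ ≤ Real.cosh (l * c) ^ n := by
    induction n with
    | zero => simp [hS]
    | succ n ih =>
      -- The coefficient of the inner product after rescaling by `l`; the factor `l * l` comes from
      -- `⟪l • S, l • d⟫`. At `S = 0` it is `0` by the convention on division, consistently with the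
      -- vanishing inner product.
      set ψ : ℝ → ℝ := fun s => l * l * (Real.sinh (l * s) * Real.sinh (l * c) / (l * s * (l * c)))
      have hψ : Measurable ψ := by
        refine ((Real.measurable_sinh.comp (measurable_id.const_mul l)).mul_const _).div ?_
          |>.const_mul _
        exact (measurable_id.const_mul l).mul_const _
      set g : Ω → ℝ := fun ω => ⟪S n ω, d n ω⟫_ℝ * ψ ‖S n ω‖
      have hle : ∀ᵐ ω ∂μ, Real.cosh (l * ‖S (n + 1) ω‖) ≤
          Real.cosh (l * ‖S n ω‖) * Real.cosh (l * c) + g ω := by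
        filter_upwards [hdc n] with ω hω
        have h := cosh_norm_add_le (l • S n ω) (l • d n ω) (mul_pos hl hc) (by
          rw [norm_smul, Real.norm_of_nonneg hl.le]; gcongr)
        rw [← smul_add, norm_smul, norm_smul, Real.norm_of_nonneg hl.le, inner_smul_left,
          inner_smul_right] at h
        simp only [hS, Finset.sum_range_succ, g, ψ] at h ⊢
        refine h.trans_eq ?_
        simp only [conj_trivial]
        ring
      have hgm : AEStronglyMeasurable g μ :=
        ((hSm n).inner (hd n)).mul (hψ.comp_aemeasurable (hSm n).norm.aemeasurable
          |>.aestronglyMeasurable)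
      have hgi : Integrable g μ := by
        refine Integrable.of_bound hgm (Real.sinh (l * (n * c)) * Real.sinh (l * c)) ?_
        filter_upwards [hdc n, hSb n] with ω hω hω'
        simp only [g, ψ]
        have h0 := mul_nonneg (Real.sinh_nonneg_iff.2 (by positivity : 0 ≤ l * ‖S n ω‖))
          (Real.sinh_nonneg_iff.2 (by positivity : 0 ≤ l * c))
        have h1 : Real.sinh (l * ‖S n ω‖) * Real.sinh (l * c) ≤
            Real.sinh (l * (n * c)) * Real.sinh (l * c) := by
          refine mul_le_mul_of_nonneg_right (Real.sinh_le_sinh.2 (by gcongr))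
            (Real.sinh_nonneg_iff.2 (by positivity))
        rcases eq_or_ne (S n ω) 0 with hz | hz
        · simp only [hz, inner_zero_left, zero_mul, norm_zero]
          exact h0.trans h1
        have hp : 0 < ‖S n ω‖ := norm_pos_iff.2 hz
        rw [norm_mul, Real.norm_of_nonneg (by positivity :
          0 ≤ l * l * (Real.sinh (l * ‖S n ω‖) * Real.sinh (l * c) / (l * ‖S n ω‖ * (l * c))))]
        calc _ ≤ (‖S n ω‖ * c) * (l * l * (Real.sinh (l * ‖S n ω‖) * Real.sinh (l * c) /
              (l * ‖S n ω‖ * (l * c)))) := by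
              gcongr
              exact (norm_inner_le_norm _ _).trans (by gcongr)
          _ = Real.sinh (l * ‖S n ω‖) * Real.sinh (l * c) := by field_simp
          _ ≤ _ := h1
      calc _ ≤ ∫ ω, (Real.cosh (l * ‖S n ω‖) * Real.cosh (l * c) + g ω) ∂μ :=
            integral_mono_ae (hci _) (((hci n).mul_const _).add hgi) hle
        _ = (∫ ω, Real.cosh (l * ‖S n ω‖) ∂μ) * Real.cosh (l * c) := by
            rw [integral_add ((hci n).mul_const _) hgi, integral_mul_const, horth n ψ hψ hgi,
              add_zero]
        _ ≤ _ := by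
            rw [pow_succ]
            exact mul_le_mul_of_nonneg_right ih (Real.cosh_pos _).le
  have hmarkov := mul_meas_ge_le_integral_of_nonneg (μ := μ)
    (ae_of_all _ fun ω => (Real.cosh_pos (l * ‖S n ω‖)).le) (hci n) (Real.exp (l * r) / 2)
  have hsub : μ.real {ω | r ≤ ‖S n ω‖} ≤
      μ.real {ω | Real.exp (l * r) / 2 ≤ Real.cosh (l * ‖S n ω‖)} := by
    refine measureReal_mono fun ω (hω : r ≤ ‖S n ω‖) => ?_
    simp only [Set.mem_ofPred_eq, Real.cosh_eq]
    have : Real.exp (l * r) ≤ Real.exp (l * ‖S n ω‖) := Real.exp_le_exp.2 (by gcongr)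
    linarith [Real.exp_pos (-(l * ‖S n ω‖))]
  have hexp : Real.cosh (l * c) ^ n ≤ Real.exp (n * (l * c) ^ 2 / 2) := by
    calc _ ≤ Real.exp ((l * c) ^ 2 / 2) ^ n :=
          pow_le_pow_left₀ (Real.cosh_pos _).le (Real.cosh_le_exp_half_sq _) n
      _ = _ := by rw [← Real.exp_nat_mul]; ring_nf
  have hpos := Real.exp_pos (l * r)
  have h1 : Real.exp (l * r) / 2 * μ.real {ω | r ≤ ‖S n ω‖} ≤ Real.exp (n * (l * c) ^ 2 / 2) :=
    (mul_le_mul_of_nonneg_left hsub (by positivity)).trans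
      (hmarkov.trans ((hstep n).trans hexp))
  rw [Real.exp_sub, mul_div_assoc', le_div_iff₀ hpos]
  linarith

/-- Almost surely, the sums of bounded orthogonal-in-the-past increments are `O(√(n log n))`. -/
lemma ae_eventually_norm_sum_le {d : ℕ → Ω → E} (hd : ∀ t, AEStronglyMeasurable (d t) μ) {c : ℝ}
    (hc : 0 < c) (hdc : ∀ t, ∀ᵐ ω ∂μ, ‖d t ω‖ ≤ c)
    (horth : ∀ t, ∀ ψ : ℝ → ℝ, Measurable ψ →
      Integrable (fun ω => ⟪∑ s ∈ Finset.range t, d s ω, d t ω⟫_ℝ *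
        ψ ‖∑ s ∈ Finset.range t, d s ω‖) μ →
      ∫ ω, ⟪∑ s ∈ Finset.range t, d s ω, d t ω⟫_ℝ * ψ ‖∑ s ∈ Finset.range t, d s ω‖ ∂μ = 0) :
    ∀ᵐ ω ∂μ, ∀ᶠ n : ℕ in atTop,
      ‖∑ s ∈ Finset.range n, d s ω‖ ≤ 2 * c * √(n * Real.log n) := by
  -- For `n ≤ 1` the logarithm vanishes and the exponent parameter chosen below would not be
  -- positive; Borel-Cantelli ignores these indices.
  set B : ℕ → Set Ω := fun n => if n ≤ 1 then ∅ else
    {ω | 2 * c * √(n * Real.log n) ≤ ‖∑ s ∈ Finset.range n, d s ω‖}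
  have hB (n : ℕ) : μ.real (B n) ≤ 2 * (1 / (n : ℝ) ^ 2) := by
    by_cases hn : n ≤ 1
    · simp only [B, if_pos hn, measureReal_empty]; positivity
    simp only [B, if_neg hn]
    have hn1 : (1 : ℝ) < n := by exact_mod_cast not_le.1 hn
    have hlog := Real.log_pos hn1
    -- This `l` minimizes `n (l c) ^ 2 / 2 - l r` at `r = 2 c √(n log n)`. The minimum is `-2 log
    -- n`, whence the summable bound `2 / n ^ 2`.
    refine (measure_norm_sum_ge_le hd hc hdc horth
      (l := 2 * √(Real.log n / n) / c) (by positivity) n _).trans_eq ?_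
    have h1 : √(Real.log n / n) * √(n * Real.log n) = Real.log n := by
      rw [← Real.sqrt_mul (by positivity)]
      have : Real.log n / n * (n * Real.log n) = Real.log n ^ 2 := by field_simp
      rw [this, Real.sqrt_sq hlog.le]
    have h2 : (2 * √(Real.log n / n) / c * c) ^ 2 = 4 * (Real.log n / n) := by
      rw [div_mul_cancel₀ _ hc.ne', mul_pow, Real.sq_sqrt (by positivity)]; norm_num
    have h3 : n * (2 * √(Real.log n / n) / c * c) ^ 2 / 2 -
        2 * √(Real.log n / n) / c * (2 * c * √(n * Real.log n)) = -(2 * Real.log n) := by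
      rw [h2]
      calc _ = n * (4 * (Real.log n / n)) / 2 -
            4 * (√(Real.log n / n) * √(n * Real.log n)) := by field_simp; ring
        _ = _ := by rw [h1]; field_simp; ring
    rw [h3, Real.exp_neg, two_mul (Real.log n), Real.exp_add, Real.exp_log (by linarith)]
    ring
  have hsum : ∑' n, μ (B n) ≠ ⊤ := by
    have hs : Summable fun n : ℕ => 2 * (1 / (n : ℝ) ^ 2) :=
      (Real.summable_one_div_nat_pow.2 one_lt_two).mul_left 2
    refine ne_top_of_le_ne_top hs.tsum_ofReal_ne_top (ENNReal.tsum_le_tsum fun n => ?_)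
    rw [← ofReal_measureReal]
    exact ENNReal.ofReal_le_ofReal (hB n)
  filter_upwards [ae_eventually_notMem hsum] with ω hω
  filter_upwards [hω, eventually_gt_atTop 1] with n hn h1
  simp only [B, if_neg (not_le.2 h1), Set.mem_ofPred_eq, not_le] at hn
  exact hn.le

end HilbertAzuma

/-! ### A strong law of large numbers under geometric mixing. -/

section MixingStrongLaw

variable {Ω : Type*} {mΩ : MeasurableSpace Ω} {μ : Measure Ω}
  {S : Type*} [MeasurableSpace S] {w : ℕ → Ω → S}

lemma StrictlyStationary.map_eq (hst : StrictlyStationary μ w) (hw : ∀ t, Measurable (w t))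
    (t : ℕ) : μ.map (w t) = μ.map (w 0) := by
  have h := congrArg (Measure.map fun v : ℕ → S => v 0) (hst t)
  rw [Measure.map_map (measurable_pi_apply 0) (measurable_pi_lambda _ fun s => hw _),
    Measure.map_map (measurable_pi_apply 0) (measurable_pi_lambda _ fun s => hw _)] at h
  simpa [Function.comp_def] using h

variable [IsProbabilityMeasure μ]

lemma GeometricallyStronglyMixing.abs_cov_le (hmix : GeometricallyStronglyMixing μ w) :
    ∃ c r : ℝ, 0 ≤ c ∧ 0 < r ∧ r < 1 ∧ ∀ (B : Set S), MeasurableSet B → ∀ n k : ℕ,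
      |μ.real (w n ⁻¹' B ∩ w (n + k) ⁻¹' B) - μ.real (w n ⁻¹' B) * μ.real (w (n + k) ⁻¹' B)| ≤
        c * r ^ k := by
  obtain ⟨c, r, hr0, hr1, h⟩ := hmix
  -- The mixing bound starts at lag `1`; the maximum with `1` covers lag `0`, where the covariance
  -- is at most `1`, and makes the constant nonnegative.
  refine ⟨max c 1, r, by positivity, hr0, hr1, fun B hB n k => ?_⟩
  rcases Nat.eq_zero_or_pos k with rfl | hk
  · have h1 : μ.real (w n ⁻¹' B) ≤ 1 := measureReal_le_one
    have h0 : 0 ≤ μ.real (w n ⁻¹' B) := measureReal_nonneg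
    simp only [add_zero, Set.inter_self, pow_zero, mul_one]
    refine le_trans ?_ (le_max_right c 1)
    rw [abs_le]
    constructor <;> nlinarith
  · refine (h k n hk _ _ ?_ ?_).trans
      (mul_le_mul_of_nonneg_right (le_max_left _ _) (by positivity))
    · exact le_iSup₂ (f := fun s (_ : s ≤ n) => MeasurableSpace.comap (w s) inferInstance)
        n le_rfl _ ⟨B, hB, rfl⟩
    · exact le_iSup₂ (f := fun s (_ : s ≥ n + k) => MeasurableSpace.comap (w s) inferInstance)
        (n + k) le_rfl _ ⟨B, hB, rfl⟩

/-- Geometrically decaying correlations of bounded variables give a linear second moment bound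
for their sums. -/
lemma integral_sq_sum_le {X : ℕ → Ω → ℝ} (hX : ∀ t, Measurable (X t)) (hX1 : ∀ t ω, |X t ω| ≤ 1)
    {c r : ℝ} (hc : 0 ≤ c) (hr0 : 0 < r) (hr1 : r < 1)
    (hcov : ∀ n k, |∫ ω, X n ω * X (n + k) ω ∂μ| ≤ c * r ^ k) (n : ℕ) :
    ∫ ω, (∑ t ∈ Finset.range n, X t ω) ^ 2 ∂μ ≤ 2 * c / (1 - r) * n := by
  have hXi (s t : ℕ) : Integrable (fun ω => X s ω * X t ω) μ := by
    refine Integrable.of_bound ((hX s).mul (hX t)).aestronglyMeasurable 1 (ae_of_all _ fun ω => ?_)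
    rw [Real.norm_eq_abs, abs_mul]
    exact mul_le_one₀ (hX1 s ω) (abs_nonneg _) (hX1 t ω)
  have hgeo (m : ℕ) : ∑ k ∈ Finset.range m, r ^ k ≤ (1 - r)⁻¹ := by
    rw [← tsum_geometric_of_lt_one hr0.le hr1]
    exact (summable_geometric_of_lt_one hr0.le hr1).sum_le_tsum _ fun k _ => by positivity
  have hg0 : 0 ≤ (1 - r)⁻¹ := inv_nonneg.2 (by linarith)
  induction n with
  | zero => simp
  | succ n ih =>
    -- Adding `X n` costs `2 ∑ E[X t X n] + E[X n ^ 2]`, at most `2 c` times a partial geometric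
    -- series, hence at most `2 c / (1 - r)` independently of `n`.
    have hexp (ω : Ω) : (∑ t ∈ Finset.range (n + 1), X t ω) ^ 2 =
        (∑ t ∈ Finset.range n, X t ω) ^ 2 +
          (2 * ∑ t ∈ Finset.range n, X t ω * X n ω + X n ω * X n ω) := by
      rw [Finset.sum_range_succ, ← Finset.sum_mul]; ring
    have hSi : Integrable (fun ω => (∑ t ∈ Finset.range n, X t ω) ^ 2) μ := by
      simp only [sq, Finset.sum_mul_sum]
      exact integrable_finsetSum _ fun s _ => integrable_finsetSum _ fun t _ => hXi s t
    have hcr : Integrable (fun ω => 2 * ∑ t ∈ Finset.range n, X t ω * X n ω) μ :=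
      (integrable_finsetSum _ fun s _ => hXi s n).const_mul 2
    have hcr2 : Integrable
        (fun ω => 2 * ∑ t ∈ Finset.range n, X t ω * X n ω + X n ω * X n ω) μ := hcr.add (hXi n n)
    simp only [hexp]
    rw [integral_add hSi hcr2, integral_add hcr (hXi n n), integral_const_mul,
      integral_finsetSum _ fun s _ => hXi s n]
    have h1 : ∑ t ∈ Finset.range n, ∫ ω, X t ω * X n ω ∂μ ≤ c * ∑ k ∈ Finset.range n, r ^ (k + 1) := by
      rw [Finset.mul_sum, ← Finset.sum_range_reflect (fun k => c * r ^ (k + 1))]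
      refine Finset.sum_le_sum fun t ht => ?_
      have ht' := Finset.mem_range.1 ht
      have h := (le_abs_self _).trans (hcov t (n - t))
      rw [show t + (n - t) = n by omega] at h
      rwa [show n - 1 - t + 1 = n - t by omega]
    have h2 : ∫ ω, X n ω * X n ω ∂μ ≤ c := by
      simpa using (le_abs_self _).trans (hcov n 0)
    have h3 : ∑ k ∈ Finset.range n, r ^ (k + 1) + 1 ≤ (1 - r)⁻¹ := by
      have := hgeo (n + 1)
      rwa [Finset.sum_range_succ', pow_zero] at this
    have h4 : c * (∑ k ∈ Finset.range n, r ^ (k + 1) + 1) ≤ c * (1 - r)⁻¹ :=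
      mul_le_mul_of_nonneg_left h3 hc
    push_cast
    rw [mul_add, mul_one, div_eq_mul_inv, mul_assoc 2] at *
    nlinarith

/-- A strong law of large numbers for bounded real variables with a linear second moment bound. -/
lemma ae_tendsto_average_of_integral_sq_le {X : ℕ → Ω → ℝ} (hX : ∀ t, Measurable (X t))
    (hX1 : ∀ t ω, |X t ω| ≤ 1) {K : ℝ}
    (h2 : ∀ n : ℕ, ∫ ω, (∑ t ∈ Finset.range n, X t ω) ^ 2 ∂μ ≤ K * n) :
    ∀ᵐ ω ∂μ, Tendsto (fun n : ℕ => (n : ℝ)⁻¹ * ∑ t ∈ Finset.range n, X t ω) atTop (𝓝 0) := by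
  set s : ℕ → Ω → ℝ := fun n ω => ∑ t ∈ Finset.range n, X t ω with hs
  have hsm (n : ℕ) : Measurable (s n) := Finset.measurable_fun_sum _ fun t _ => hX t
  have hsb (n : ℕ) (ω : Ω) : |s n ω| ≤ n := by
    refine (Finset.abs_sum_le_sum_abs _ _).trans ((Finset.sum_le_sum fun t _ => hX1 t ω).trans ?_)
    simp
  have hsi (n : ℕ) : Integrable (fun ω => s n ω ^ 2) μ := by
    refine Integrable.of_bound ((hsm n).pow_const 2).aestronglyMeasurable ((n : ℝ) ^ 2)
      (ae_of_all _ fun ω => ?_)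
    rw [norm_pow, Real.norm_eq_abs]
    exact pow_le_pow_left₀ (abs_nonneg _) (hsb n ω) 2
  -- Chebyshev is summable only along the squares `m ^ 2`: there it gives `K m ^ 2 / (ε m ^ 2) ^ 2`.
  have hprob (ε : ℝ) (hε : 0 < ε) (m : ℕ) :
      μ.real {ω | 1 ≤ m ∧ ε * (m : ℝ) ^ 2 < |s (m ^ 2) ω|} ≤ K / ε ^ 2 * (1 / (m : ℝ) ^ 2) := by
    rcases Nat.eq_zero_or_pos m with rfl | hm
    · simp
    have hm' : (0 : ℝ) < m := by exact_mod_cast hm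
    have hmk := mul_meas_ge_le_integral_of_nonneg (μ := μ)
      (ae_of_all _ fun ω => sq_nonneg (s (m ^ 2) ω)) (hsi _) ((ε * (m : ℝ) ^ 2) ^ 2)
    have hsub : μ.real {ω | 1 ≤ m ∧ ε * (m : ℝ) ^ 2 < |s (m ^ 2) ω|} ≤
        μ.real {ω | (ε * (m : ℝ) ^ 2) ^ 2 ≤ s (m ^ 2) ω ^ 2} := by
      refine measureReal_mono fun ω hω => ?_
      have := pow_le_pow_left₀ (by positivity) hω.2.le 2
      rwa [sq_abs] at this
    have hK := h2 (m ^ 2)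
    push_cast at hK
    have := (mul_le_mul_of_nonneg_left hsub (by positivity)).trans (hmk.trans hK)
    rw [← le_div_iff₀' (by positivity)] at this
    refine this.trans_eq ?_
    field_simp
  have hsq (k : ℕ) : ∀ᵐ ω ∂μ, ∀ᶠ m : ℕ in atTop,
      |s (m ^ 2) ω| ≤ (1 / ((k : ℝ) + 1)) * (m : ℝ) ^ 2 := by
    have hk : 0 < 1 / ((k : ℝ) + 1) := by positivity
    have hsum : ∑' m : ℕ, μ {ω | 1 ≤ m ∧ 1 / ((k : ℝ) + 1) * (m : ℝ) ^ 2 < |s (m ^ 2) ω|} ≠ ⊤ := by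
      have hs : Summable fun m : ℕ => K / (1 / ((k : ℝ) + 1)) ^ 2 * (1 / (m : ℝ) ^ 2) :=
        (Real.summable_one_div_nat_pow.2 one_lt_two).mul_left _
      refine ne_top_of_le_ne_top hs.tsum_ofReal_ne_top (ENNReal.tsum_le_tsum fun n => ?_)
      rw [← ofReal_measureReal]
      exact ENNReal.ofReal_le_ofReal (hprob _ hk n)
    filter_upwards [ae_eventually_notMem hsum] with ω hω
    filter_upwards [hω, eventually_ge_atTop 1] with m hm h1
    by_contra! hlt
    exact hm ⟨h1, hlt⟩
  filter_upwards [ae_all_iff.2 hsq] with ω hω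
  rw [Metric.tendsto_atTop]
  intro ε hε
  obtain ⟨k, hk⟩ := exists_nat_one_div_lt (half_pos hε)
  obtain ⟨M, hM⟩ := eventually_atTop.1 (hω k)
  obtain ⟨N, hN⟩ := exists_nat_gt (4 / ε)
  refine ⟨max (max (M ^ 2) (N ^ 2)) 1, fun n hn => ?_⟩
  simp only [ge_iff_le, max_le_iff] at hn
  obtain ⟨⟨hnM, hnN⟩, hn1⟩ := hn
  -- Between consecutive squares the sum moves by at most `2 m`, which is below `ε / 2 * m ^ 2`
  -- since `m > 4 / ε`.
  set m := Nat.sqrt n with hm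
  have hmn : m ^ 2 ≤ n := Nat.sqrt_le' n
  have hnm : n ≤ m ^ 2 + 2 * m := by
    have := Nat.sqrt_le_add n; simp only [← hm] at this; nlinarith
  have hMm : M ≤ m := Nat.le_sqrt'.2 hnM
  have hNm : N ≤ m := Nat.le_sqrt'.2 hnN
  have hdiff : |s n ω - s (m ^ 2) ω| ≤ 2 * m := by
    simp only [hs]
    rw [← Finset.sum_Ico_eq_sub _ hmn]
    refine (Finset.abs_sum_le_sum_abs _ _).trans ((Finset.sum_le_sum fun t _ => hX1 t ω).trans ?_)
    simp only [Finset.sum_const, Nat.card_Ico, nsmul_eq_mul, mul_one]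
    have : n - m ^ 2 ≤ 2 * m := by omega
    exact_mod_cast this
  have hn0 : (0 : ℝ) < n := by exact_mod_cast hn1
  have hmnR : (m : ℝ) ^ 2 ≤ n := by exact_mod_cast hmn
  have hmN : 4 / ε < m := hN.trans_le (by exact_mod_cast hNm)
  have hm0 : (0 : ℝ) < m := lt_trans (by positivity) hmN
  rw [Real.dist_eq, sub_zero, abs_mul, abs_of_pos (inv_pos.2 hn0), inv_mul_lt_iff₀ hn0]
  have h4 : 2 * (m : ℝ) < ε / 2 * m ^ 2 := by
    rw [div_lt_iff₀ hε] at hmN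
    nlinarith
  have h5 : 1 / ((k : ℝ) + 1) * (m : ℝ) ^ 2 ≤ ε / 2 * m ^ 2 := by gcongr
  have h6 : |s n ω| ≤ |s n ω - s (m ^ 2) ω| + |s (m ^ 2) ω| := by
    have := abs_add_le (s n ω - s (m ^ 2) ω) (s (m ^ 2) ω)
    rwa [sub_add_cancel] at this
  have h7 := hM m hMm
  nlinarith

/-- Relative frequencies of a stationary geometrically mixing process converge. -/
lemma ae_tendsto_average_indicator (hw : ∀ t, Measurable (w t)) (hst : StrictlyStationary μ w)
    (hmix : GeometricallyStronglyMixing μ w) {B : Set S} (hB : MeasurableSet B) :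
    ∀ᵐ ω ∂μ, Tendsto
      (fun n : ℕ => (n : ℝ)⁻¹ * ∑ t ∈ Finset.range n, B.indicator (1 : S → ℝ) (w t ω)) atTop
      (𝓝 ((μ.map (w 0)).real B)) := by
  obtain ⟨c, r, hc, hr0, hr1, hcov⟩ := hmix.abs_cov_le
  set p := (μ.map (w 0)).real B with hp
  have hpt (t : ℕ) : μ.real (w t ⁻¹' B) = p := by
    rw [hp, ← hst.map_eq hw t, map_measureReal_apply (hw t) hB]
  have hp0 : 0 ≤ p := measureReal_nonneg
  have hp1 : p ≤ 1 := by rw [← hpt 0]; exact measureReal_le_one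
  set X : ℕ → Ω → ℝ := fun t ω => B.indicator (1 : S → ℝ) (w t ω) - p with hX
  have hXm (t : ℕ) : Measurable (X t) :=
    ((measurable_one.indicator hB).comp (hw t)).sub_const p
  have hX1 (t : ℕ) (ω : Ω) : |X t ω| ≤ 1 := by
    simp only [hX]
    by_cases h : w t ω ∈ B
    · rw [Set.indicator_of_mem h, Pi.one_apply, abs_le]; constructor <;> linarith
    · rw [Set.indicator_of_notMem h, abs_le]; constructor <;> linarith
  -- The centred indicators have as correlations exactly the event covariances that mixing controls.
  have hprod (n k : ℕ) : ∫ ω, X n ω * X (n + k) ω ∂μ =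
      μ.real (w n ⁻¹' B ∩ w (n + k) ⁻¹' B) - μ.real (w n ⁻¹' B) * μ.real (w (n + k) ⁻¹' B) := by
    have hm (t : ℕ) : MeasurableSet (w t ⁻¹' B) := hw t hB
    have hi (D : Set Ω) (hD : MeasurableSet D) : Integrable (D.indicator (1 : Ω → ℝ)) μ :=
      (integrable_const (1 : ℝ)).indicator hD
    have heq (ω : Ω) : X n ω * X (n + k) ω =
        (w n ⁻¹' B ∩ w (n + k) ⁻¹' B).indicator (1 : Ω → ℝ) ω -
          (p * (w n ⁻¹' B).indicator (1 : Ω → ℝ) ω +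
            (p * (w (n + k) ⁻¹' B).indicator (1 : Ω → ℝ) ω - p * p)) := by
      simp only [hX, Set.indicator, Set.mem_inter_iff, Set.mem_preimage, Pi.one_apply]
      by_cases h1 : w n ω ∈ B <;> by_cases h2 : w (n + k) ω ∈ B <;> simp [h1, h2] <;> ring
    simp only [heq]
    have hi2 : Integrable
        (fun ω => p * (w (n + k) ⁻¹' B).indicator (1 : Ω → ℝ) ω - p * p) μ :=
      ((hi _ (hm _)).const_mul p).sub (integrable_const _)
    have hi3 : Integrable (fun ω => p * (w n ⁻¹' B).indicator (1 : Ω → ℝ) ω +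
        (p * (w (n + k) ⁻¹' B).indicator (1 : Ω → ℝ) ω - p * p)) μ :=
      ((hi _ (hm _)).const_mul p).add hi2
    rw [integral_sub (hi _ ((hm _).inter (hm _))) hi3,
      integral_add ((hi _ (hm _)).const_mul p) hi2,
      integral_sub ((hi _ (hm _)).const_mul p) (integrable_const _), integral_const_mul,
      integral_const_mul, integral_indicator_one (hm _), integral_indicator_one (hm _),
      integral_indicator_one ((hm _).inter (hm _)), hpt, hpt]
    simp
  have h2 := integral_sq_sum_le (μ := μ) hXm hX1 hc hr0 hr1
    (fun n k => by rw [hprod]; exact hcov B hB n k)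
  filter_upwards [ae_tendsto_average_of_integral_sq_le hXm hX1 h2] with ω hω
  have h := hω.add_const p
  rw [zero_add] at h
  refine h.congr' ?_
  filter_upwards [eventually_ge_atTop 1] with n hn
  have hn0 : (n : ℝ) ≠ 0 := by positivity
  simp only [hX, Finset.sum_sub_distrib, Finset.sum_const, Finset.card_range, nsmul_eq_mul]
  field_simp
  ring

variable {E : Type*} [NormedAddCommGroup E] [NormedSpace ℝ E] [CompleteSpace E]

lemma ae_tendsto_average_simpleFunc (hw : ∀ t, Measurable (w t)) (hst : StrictlyStationary μ w)
    (hmix : GeometricallyStronglyMixing μ w) (g : SimpleFunc S E) :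
    ∀ᵐ ω ∂μ, Tendsto
      (fun n : ℕ => (n : ℝ)⁻¹ • ∑ t ∈ Finset.range n, g (w t ω)) atTop
      (𝓝 (∫ s, g s ∂μ.map (w 0))) := by
  have : IsProbabilityMeasure (μ.map (w 0)) := Measure.isProbabilityMeasure_map (hw 0).aemeasurable
  have hall : ∀ᵐ ω ∂μ, ∀ y ∈ g.range, Tendsto (fun n : ℕ => (n : ℝ)⁻¹ *
      ∑ t ∈ Finset.range n, (g ⁻¹' {y}).indicator (1 : S → ℝ) (w t ω)) atTop
      (𝓝 ((μ.map (w 0)).real (g ⁻¹' {y}))) := by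
    rw [Filter.eventually_all_finset]
    exact fun y _ => ae_tendsto_average_indicator hw hst hmix (g.measurableSet_preimage _)
  filter_upwards [hall] with ω hω
  rw [← SimpleFunc.integral_eq_integral _ (SimpleFunc.integrable_of_isFiniteMeasure g),
    SimpleFunc.integral_eq]
  refine (tendsto_finsetSum _ fun y hy => (hω y hy).smul_const y).congr fun n => ?_
  have hg (s : S) : g s = ∑ y ∈ g.range, (g ⁻¹' {y}).indicator (1 : S → ℝ) s • y := by
    rw [Finset.sum_eq_single (g s)]
    · simp
    · intro y _ hy
      rw [Set.indicator_of_notMem (by simpa using hy.symm), zero_smul]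
    · intro h; exact absurd (g.mem_range_self s) h
  simp_rw [mul_smul, ← Finset.smul_sum]
  congr 1
  simp_rw [Finset.sum_smul]
  rw [Finset.sum_comm]
  exact Finset.sum_congr rfl fun t _ => (hg _).symm

/-- The strong law of large numbers for bounded functions of a stationary geometrically mixing
process. -/
lemma ae_tendsto_average_of_bounded (hw : ∀ t, Measurable (w t)) (hst : StrictlyStationary μ w)
    (hmix : GeometricallyStronglyMixing μ w) {g : S → E} (hg : StronglyMeasurable g) {M : ℝ}
    (hM : ∀ s, ‖g s‖ ≤ M) :
    ∀ᵐ ω ∂μ, Tendsto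
      (fun n : ℕ => (n : ℝ)⁻¹ • ∑ t ∈ Finset.range n, g (w t ω)) atTop
      (𝓝 (∫ s, g s ∂μ.map (w 0))) := by
  set ν := μ.map (w 0) with hν
  have : IsProbabilityMeasure ν := Measure.isProbabilityMeasure_map (hw 0).aemeasurable
  have hgi : Integrable g ν := Integrable.of_bound hg.aestronglyMeasurable M (ae_of_all _ hM)
  set G : ℕ → SimpleFunc S E := fun k => hg.approxBounded M k with hG
  have hS : Nonempty S := by
    by_contra h
    rw [not_nonempty_iff] at h
    exact IsProbabilityMeasure.ne_zero ν (Measure.eq_zero_of_isEmpty ν)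
  have hM0 : 0 ≤ M := (norm_nonneg _).trans (hM hS.some)
  have hGM (k : ℕ) (s : S) : ‖G k s‖ ≤ M := hg.norm_approxBounded_le hM0 k s
  have hGt (s : S) : Tendsto (fun k => G k s) atTop (𝓝 (g s)) :=
    hg.tendsto_approxBounded_of_norm_le (hM s)
  have hint : Tendsto (fun k => ∫ s, G k s ∂ν) atTop (𝓝 (∫ s, g s ∂ν)) :=
    tendsto_integral_of_dominated_convergence (fun _ => M)
      (fun k => (G k).stronglyMeasurable.aestronglyMeasurable) (integrable_const M)
      (fun k => ae_of_all _ (hGM k)) (ae_of_all _ hGt)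
  -- The approximation by `G k` is only pointwise. Outside this bad set the error is small, on it at
  -- most `2 M`, and the frequency of visits to it obeys the law for indicators.
  have hmeas (ε : ℝ) (k : ℕ) : MeasurableSet {s | ε ≤ ‖g s - G k s‖} :=
    (hg.sub (G k).stronglyMeasurable).norm.measurable measurableSet_Ici
  have hprob (ε : ℝ) (hε : 0 < ε) :
      Tendsto (fun k => ν.real {s | ε ≤ ‖g s - G k s‖}) atTop (𝓝 0) := by
    have h := (tendstoInMeasure_iff_norm.1 (tendstoInMeasure_of_tendsto_ae
      (fun k => (G k).stronglyMeasurable.aestronglyMeasurable) (ae_of_all ν hGt))) ε hε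
    have h' := (ENNReal.tendsto_toReal ENNReal.zero_ne_top).comp h
    simpa only [Function.comp_def, ENNReal.toReal_zero, norm_sub_rev, ← measureReal_def] using h'
  have h1 : ∀ᵐ ω ∂μ, ∀ k, Tendsto (fun n : ℕ => (n : ℝ)⁻¹ • ∑ t ∈ Finset.range n, G k (w t ω))
      atTop (𝓝 (∫ s, G k s ∂ν)) :=
    ae_all_iff.2 fun k => ae_tendsto_average_simpleFunc hw hst hmix (G k)
  have h2 : ∀ᵐ ω ∂μ, ∀ j k : ℕ, Tendsto (fun n : ℕ => (n : ℝ)⁻¹ * ∑ t ∈ Finset.range n,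
      {s | 1 / ((j : ℝ) + 1) ≤ ‖g s - G k s‖}.indicator (1 : S → ℝ) (w t ω)) atTop
      (𝓝 (ν.real {s | 1 / ((j : ℝ) + 1) ≤ ‖g s - G k s‖})) :=
    ae_all_iff.2 fun j => ae_all_iff.2 fun k => ae_tendsto_average_indicator hw hst hmix (hmeas _ k)
  filter_upwards [h1, h2] with ω hω1 hω2
  rw [Metric.tendsto_nhds]
  intro ε hε
  obtain ⟨j, hj⟩ := exists_nat_one_div_lt (by positivity : 0 < ε / 5)
  set δ := 1 / ((j : ℝ) + 1) with hδ
  have hδ0 : 0 < δ := by positivity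
  have hprob' := (hprob δ hδ0).const_mul (2 * M)
  rw [mul_zero] at hprob'
  -- One `k` serves for both the mass of the bad set and the error in the integral. Four errors
  -- below `ε / 5` then add up; the thresholds `1 / (j + 1)` keep the exceptional null sets
  -- countable in number.
  obtain ⟨k, hk1, hk2⟩ := ((hprob'.eventually (gt_mem_nhds (by positivity : 0 < ε / 5))).and
    (Metric.tendsto_nhds.1 hint (ε / 5) (by positivity))).exists
  have hω2' := ((hω2 j k).const_mul (2 * M)).eventually (gt_mem_nhds hk1)
  filter_upwards [hω2', Metric.tendsto_nhds.1 (hω1 k) (ε / 5) (by positivity),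
    eventually_ge_atTop 1] with n hn1 hn2 hn
  have hn0 : (0 : ℝ) < n := by exact_mod_cast hn
  have hpt (s : S) : ‖g s - G k s‖ ≤
      δ + 2 * M * {s | δ ≤ ‖g s - G k s‖}.indicator (1 : S → ℝ) s := by
    by_cases h : δ ≤ ‖g s - G k s‖
    · rw [Set.indicator_of_mem (by exact h), Pi.one_apply, mul_one]
      linarith [norm_sub_le (g s) (G k s), hM s, hGM k s]
    · rw [Set.indicator_of_notMem (by exact h)]
      linarith [not_le.1 h]
  have hdiff : ‖(n : ℝ)⁻¹ • ∑ t ∈ Finset.range n, g (w t ω) -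
      (n : ℝ)⁻¹ • ∑ t ∈ Finset.range n, G k (w t ω)‖ ≤ δ + 2 * M * ((n : ℝ)⁻¹ *
        ∑ t ∈ Finset.range n, {s | δ ≤ ‖g s - G k s‖}.indicator (1 : S → ℝ) (w t ω)) := by
    rw [← smul_sub, ← Finset.sum_sub_distrib, norm_smul, Real.norm_of_nonneg (by positivity)]
    calc _ ≤ (n : ℝ)⁻¹ * ∑ t ∈ Finset.range n,
          (δ + 2 * M * {s | δ ≤ ‖g s - G k s‖}.indicator (1 : S → ℝ) (w t ω)) := by
          gcongr
          exact norm_sum_le_of_le _ fun t _ => hpt _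
      _ = _ := by
          rw [Finset.sum_add_distrib, ← Finset.mul_sum]
          simp only [Finset.sum_const, Finset.card_range, nsmul_eq_mul]
          field_simp
  rw [dist_eq_norm] at *
  have htri := norm_add₃_le
    (a := (n : ℝ)⁻¹ • ∑ t ∈ Finset.range n, g (w t ω) -
      (n : ℝ)⁻¹ • ∑ t ∈ Finset.range n, G k (w t ω))
    (b := (n : ℝ)⁻¹ • ∑ t ∈ Finset.range n, G k (w t ω) - ∫ s, G k s ∂ν)
    (c := ∫ s, G k s ∂ν - ∫ s, g s ∂ν)
  simp only [sub_add_sub_cancel] at htri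
  linarith

end MixingStrongLaw

/-! ### Spectral cut-off: bias and size of the regularized inverse. -/

section SpectralProjection

variable {H : Type*} [NormedAddCommGroup H] [InnerProductSpace ℝ H]

@[simp]
lemma tensor_apply (a b v : H) : tensor a b v = ⟪a, v⟫_ℝ • b := by
  simp [tensor]

/-- The orthogonal projection onto the span of the first `K` vectors of an orthonormal family. -/
noncomputable def spectralProj (e : ℕ → H) (K : ℕ) : H →L[ℝ] H :=
  ∑ j ∈ Finset.range K, tensor (e j) (e j)

lemma spectralProj_apply (e : ℕ → H) (K : ℕ) (v : H) :
    spectralProj e K v = ∑ j ∈ Finset.range K, ⟪e j, v⟫_ℝ • e j := by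
  simp [spectralProj]

lemma norm_sq_sum_smul {e : ℕ → H} (he : Orthonormal ℝ e) (s : Finset ℕ) (a : ℕ → ℝ) :
    ‖∑ j ∈ s, a j • e j‖ ^ 2 = ∑ j ∈ s, a j ^ 2 := by
  rw [← real_inner_self_eq_norm_sq, he.inner_sum]
  simp [sq]

lemma sum_sq_inner_le {e : ℕ → H} (he : Orthonormal ℝ e) (s : Finset ℕ) (v : H) :
    ∑ j ∈ s, ⟪e j, v⟫_ℝ ^ 2 ≤ ‖v‖ ^ 2 := by
  simpa using he.sum_inner_products_le (s := s) v

lemma inner_sub_spectralProj_comm (e : ℕ → H) (K : ℕ) (v w : H) :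
    ⟪v, w - spectralProj e K w⟫_ℝ = ⟪v - spectralProj e K v, w⟫_ℝ := by
  rw [inner_sub_left, inner_sub_right, spectralProj_apply, spectralProj_apply, inner_sum, sum_inner]
  congr 1
  refine Finset.sum_congr rfl fun j _ => ?_
  rw [inner_smul_left, inner_smul_right, real_inner_comm v]
  simp [mul_comm]

lemma norm_sub_spectralProj_le {e : ℕ → H} (he : Orthonormal ℝ e) (K : ℕ) (v : H) :
    ‖v - spectralProj e K v‖ ≤ ‖v‖ := by
  refine (sq_le_sq₀ (norm_nonneg _) (norm_nonneg v)).1 ?_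
  rw [norm_sub_sq_real, spectralProj_apply, norm_sq_sum_smul he, inner_sum]
  have h (j : ℕ) : ⟪v, ⟪e j, v⟫_ℝ • e j⟫_ℝ = ⟪e j, v⟫_ℝ ^ 2 := by
    rw [inner_smul_right, real_inner_comm]; ring
  simp only [h]
  linarith [Finset.sum_nonneg fun j (_ : j ∈ Finset.range K) => sq_nonneg ⟪e j, v⟫_ℝ]

namespace SpectralDecomposition

variable {C : H →L[ℝ] H} {ev : ℕ → ℝ} {e : ℕ → H} (h : SpectralDecomposition C ev e)
include h

lemma apply_eigenvector (j : ℕ) : C (e j) = ev j • e j := by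
  refine (h.hasSum (e j)).unique ?_
  have := hasSum_single (f := fun i => ev i • tensor (e i) (e i) (e j)) j fun i hi => by
    simp [h.orthonormal.2 hi]
  simpa [h.orthonormal.1 j] using this

/-- What remains has coefficients `ev j * ⟪e j, v⟫` with `ev j ≤ α`, so Bessel's inequality applies.
The threshold bounds the bias through this estimate. -/
lemma norm_apply_sub_spectralProj_apply_le {α : ℝ} (hα : 0 ≤ α) {K : ℕ}
    (hK : ∀ j, K ≤ j → ev j ≤ α) (v : H) :
    ‖C v - spectralProj e K (C v)‖ ≤ α * ‖v‖ := by
  have hcoef (j : ℕ) : ⟪e j, C v⟫_ℝ = ev j * ⟪e j, v⟫_ℝ := by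
    have h1 := (h.hasSum v).mapL (innerSL ℝ (e j))
    have h2 := hasSum_single (f := fun i => innerSL ℝ (e j) (ev i • tensor (e i) (e i) v)) j
      fun i hi => by simp [h.orthonormal.2 hi.symm]
    have h3 := h1.unique h2
    simpa [inner_smul_right, h.orthonormal.1 j] using h3
  have hproj : spectralProj e K (C v) =
      ∑ j ∈ Finset.range K, ev j • tensor (e j) (e j) v := by
    simp [spectralProj_apply, hcoef, mul_smul]
  have hlim := ((h.hasSum v).tendsto_sum_nat.sub_const (spectralProj e K (C v))).norm
  refine le_of_tendsto hlim ?_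
  filter_upwards [eventually_ge_atTop K] with N hN
  rw [hproj, ← Finset.sum_Ico_eq_sub _ hN]
  refine (sq_le_sq₀ (norm_nonneg _) (by positivity)).1 ?_
  simp only [tensor_apply, smul_smul]
  rw [norm_sq_sum_smul h.orthonormal, mul_pow]
  calc _ ≤ ∑ j ∈ Finset.Ico K N, α ^ 2 * ⟪e j, v⟫_ℝ ^ 2 := by
        refine Finset.sum_le_sum fun j hj => ?_
        rw [mul_pow]
        exact mul_le_mul_of_nonneg_right
          (pow_le_pow_left₀ (h.nonneg j) (hK j (Finset.mem_Ico.1 hj).1) 2) (sq_nonneg _)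
    _ ≤ _ := by
        rw [← Finset.mul_sum]
        exact mul_le_mul_of_nonneg_left (sum_sq_inner_le h.orthonormal _ v) (sq_nonneg α)

/-- Eigenvectors with positive eigenvalue lie in the range. Finiteness matters because `Set.ncard`
is `0` on infinite sets, which would falsify `numRetained`. -/
lemma finite_setOf_lt [FiniteDimensional ℝ C.range] {α : ℝ} (hα : 0 ≤ α) :
    {j | α < ev j}.Finite := by
  have hmem (j : {j | α < ev j}) : e j ∈ C.range := by
    have hj : 0 < ev j := hα.trans_lt j.2
    refine ⟨(ev j)⁻¹ • e j, ?_⟩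
    simp only [ContinuousLinearMap.coe_coe]
    rw [map_smul, h.apply_eigenvector, inv_smul_smul₀ hj.ne']
  have hli : LinearIndependent ℝ fun j : {j | α < ev j} => (⟨e j, hmem j⟩ : C.range) := by
    have := h.orthonormal.linearIndependent.comp (fun j : {j | α < ev j} => (j : ℕ))
      Subtype.val_injective
    exact LinearIndependent.of_comp C.range.subtype this
  exact Set.finite_coe_iff.1 hli.finite

/-- As `ev` is antitone, the retained indices form an initial segment, and its length is their
number. -/
lemma lt_numRetained_iff [FiniteDimensional ℝ C.range] {α : ℝ} (hα : 0 ≤ α) (j : ℕ) :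
    j < numRetained ev α ↔ α < ev j := by
  have hfin := h.finite_setOf_lt hα
  constructor
  · intro hj
    by_contra! hle
    have hsub : {i | α < ev i} ⊆ Finset.range j := fun i (hi : α < ev i) => by
      rw [Finset.coe_range, Set.mem_Iio]
      by_contra! hji
      exact absurd (hi.trans_le (h.antitone hji)) (not_lt.2 hle)
    have := Set.ncard_le_ncard hsub (Finset.finite_toSet _)
    rw [Set.ncard_coe_finset, Finset.card_range] at this
    exact absurd hj (not_lt.2 this)
  · intro hj
    have hsub : (Finset.range (j + 1) : Set ℕ) ⊆ {i | α < ev i} := fun i hi => by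
      rw [Finset.coe_range, Set.mem_Iio] at hi
      exact hj.trans_le (h.antitone (by omega))
    have := Set.ncard_le_ncard hsub hfin
    rw [Set.ncard_coe_finset, Finset.card_range] at this
    exact this

lemma comp_regInverse {K : ℕ} (hK : ∀ j < K, 0 < ev j) :
    C ∘L regInverse ev e K = spectralProj e K := by
  ext v
  simp only [regInverse, spectralProj, ContinuousLinearMap.comp_apply,
    sum_apply, smul_apply, map_sum, map_smul, tensor_apply]
  refine Finset.sum_congr rfl fun j hj => ?_
  rw [h.apply_eigenvector, smul_smul, smul_smul, mul_right_comm,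
    inv_mul_cancel₀ (hK j (Finset.mem_range.1 hj)).ne', one_mul]

end SpectralDecomposition

variable [CompleteSpace H]

/-- With `R` the regularized inverse, `‖B R v‖ ^ 2 = ⟪B* B R v, R v⟫ = ⟪P v, R v⟫`, a sum of `(ev
j)⁻¹ ⟪e j, v⟫ ^ 2`. Keeping `B` with `R` yields `α^(-1/2)` where `R` alone would give `α⁻¹`. -/
lemma norm_comp_regInverse_le {B : H →L[ℝ] H} {ev : ℕ → ℝ} {e : ℕ → H}
    (h : SpectralDecomposition (B.adjoint ∘L B) ev e) {α : ℝ} (hα : 0 < α) {K : ℕ}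
    (hK : ∀ j < K, α < ev j) : ‖B ∘L regInverse ev e K‖ ≤ √(α⁻¹) := by
  refine ContinuousLinearMap.opNorm_le_bound _ (Real.sqrt_nonneg _) fun v => ?_
  refine (sq_le_sq₀ (norm_nonneg _) (by positivity)).1 ?_
  rw [mul_pow, Real.sq_sqrt (by positivity), ContinuousLinearMap.comp_apply,
    ← real_inner_self_eq_norm_sq, ← ContinuousLinearMap.adjoint_inner_left]
  have hcomp := congrArg (fun L : H →L[ℝ] H => L v)
    (h.comp_regInverse fun j hj => hα.trans (hK j hj))
  simp only [ContinuousLinearMap.comp_apply] at hcomp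
  rw [hcomp, spectralProj_apply]
  have hR : regInverse ev e K v = ∑ j ∈ Finset.range K, ((ev j)⁻¹ * ⟪e j, v⟫_ℝ) • e j := by
    simp [regInverse, smul_smul]
  rw [hR, h.orthonormal.inner_sum]
  calc _ ≤ ∑ j ∈ Finset.range K, α⁻¹ * ⟪e j, v⟫_ℝ ^ 2 := by
        refine Finset.sum_le_sum fun j hj => ?_
        have := inv_anti₀ hα (hK j (Finset.mem_range.1 hj)).le
        simp only [conj_trivial]
        nlinarith [sq_nonneg ⟪e j, v⟫_ℝ]
    _ ≤ _ := by
        rw [← Finset.mul_sum]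
        exact mul_le_mul_of_nonneg_left (sum_sq_inner_le h.orthonormal _ v) (by positivity)

/-- A vector orthogonal to every `f j` is annihilated by `C`. -/
lemma SpectralDecomposition.dense_span {C : H →L[ℝ] H} {lam : ℕ → ℝ} {f : ℕ → H}
    (h : SpectralDecomposition C lam f) (hinj : ∀ v, C v = 0 → v = 0) :
    (Submodule.span ℝ (Set.range f)).topologicalClosure = ⊤ := by
  rw [Submodule.topologicalClosure_eq_top_iff, Submodule.eq_bot_iff]
  intro v hv
  have hz (j : ℕ) : ⟪f j, v⟫_ℝ = 0 :=
    (Submodule.mem_orthogonal _ v).1 hv _ (Submodule.subset_span ⟨j, rfl⟩)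
  refine hinj v ((h.hasSum v).unique ?_)
  simp [hz]

omit [CompleteSpace H] in
/-- Convergence to zero of contractions is inherited from a set with dense span. -/
lemma tendsto_zero_of_dense_span {Q : ℕ → H →L[ℝ] H} (hQ : ∀ n v, ‖Q n v‖ ≤ ‖v‖) {s : Set H}
    (hs : (Submodule.span ℝ s).topologicalClosure = ⊤)
    (h : ∀ v ∈ s, Tendsto (fun n => Q n v) atTop (𝓝 0)) (v : H) :
    Tendsto (fun n => Q n v) atTop (𝓝 0) := by
  have hspan : ∀ w ∈ Submodule.span ℝ s, Tendsto (fun n => Q n w) atTop (𝓝 0) := by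
    intro w hw
    induction hw using Submodule.span_induction with
    | mem x hx => exact h x hx
    | zero => simp
    | add x y _ _ hx hy => simpa using hx.add hy
    | smul a x _ hx => simpa using hx.const_smul a
  rw [Metric.tendsto_nhds]
  intro ε hε
  have hv : v ∈ closure (Submodule.span ℝ s : Set H) := by
    rw [← Submodule.topologicalClosure_coe, hs]; trivial
  obtain ⟨w, hw, hvw⟩ := Metric.mem_closure_iff.1 hv (ε / 2) (by positivity)
  filter_upwards [Metric.tendsto_nhds.1 (hspan w hw) (ε / 2) (by positivity)] with n hn
  rw [dist_zero_right] at hn ⊢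
  rw [dist_eq_norm] at hvw
  have h1 : Q n v = Q n (v - w) + Q n w := by simp
  rw [h1]
  linarith [norm_add_le (Q n (v - w)) (Q n w), hQ n (v - w)]

/-- A Hilbert-Schmidt operator turns strong convergence to zero of self-adjoint contractions into
norm convergence. -/
lemma IsHilbertSchmidt.tendsto_norm_comp {A : H →L[ℝ] H} (hA : IsHilbertSchmidt A)
    {Q : ℕ → H →L[ℝ] H} (hQ : ∀ n v, ‖Q n v‖ ≤ ‖v‖)
    (hsymm : ∀ n v w, ⟪v, Q n w⟫_ℝ = ⟪Q n v, w⟫_ℝ)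
    (h : ∀ v, Tendsto (fun n => Q n v) atTop (𝓝 0)) :
    Tendsto (fun n => ‖A ∘L Q n‖) atTop (𝓝 0) := by
  classical
  rw [Metric.tendsto_nhds]
  intro ε hε
  -- Outside `F` the squared norms of the images under `A` sum to at most `(ε / 3) ^ 2`, so by
  -- Cauchy-Schwarz this part of `A` has operator norm at most `ε / 3`.
  obtain ⟨F, hF⟩ := summable_iff_vanishing_norm.1 hA ((ε / 3) ^ 2) (by positivity)
  have htail (v : H) : ‖A v - ∑ i ∈ F, ⟪stdBasis H i, v⟫_ℝ • A (stdBasis H i)‖ ≤ ε / 3 * ‖v‖ := by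
    have hsum : HasSum (fun i => ⟪stdBasis H i, v⟫_ℝ • A (stdBasis H i)) (A v) := by
      have := ((stdBasis H).hasSum_repr v).mapL A
      simpa [HilbertBasis.repr_apply_apply] using this
    refine le_of_tendsto ((Filter.Tendsto.sub_const hsum _).norm) ?_
    filter_upwards [eventually_ge_atTop F] with G hG
    rw [← Finset.sum_sdiff_eq_sub hG]
    refine (norm_sum_le _ _).trans ?_
    simp only [norm_smul]
    have h1 : ∑ i ∈ G \ F, ‖⟪stdBasis H i, v⟫_ℝ‖ ^ 2 ≤ ‖v‖ ^ 2 :=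
      (stdBasis H).orthonormal.sum_inner_products_le v
    have h2 : ∑ i ∈ G \ F, ‖A (stdBasis H i)‖ ^ 2 ≤ (ε / 3) ^ 2 :=
      (le_abs_self _).trans (hF _ Finset.sdiff_disjoint).le
    refine (sq_le_sq₀ (by positivity) (by positivity)).1 ?_
    calc _ ≤ (∑ i ∈ G \ F, ‖⟪stdBasis H i, v⟫_ℝ‖ ^ 2) * ∑ i ∈ G \ F, ‖A (stdBasis H i)‖ ^ 2 :=
          Finset.sum_mul_sq_le_sq_mul_sq _ _ _
      _ ≤ ‖v‖ ^ 2 * (ε / 3) ^ 2 := by gcongr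
      _ = _ := by ring
  have hfin : Tendsto (fun n => ∑ i ∈ F, ‖Q n (stdBasis H i)‖ * ‖A (stdBasis H i)‖) atTop
      (𝓝 0) := by
    have := tendsto_finsetSum F fun i _ => ((h (stdBasis H i)).norm.mul_const ‖A (stdBasis H i)‖)
    simpa using this
  filter_upwards [Metric.tendsto_nhds.1 hfin (ε / 3) (by positivity)] with n hn
  rw [dist_zero_right, Real.norm_eq_abs] at hn
  rw [dist_zero_right, norm_norm]
  refine (ContinuousLinearMap.opNorm_le_bound _ (by positivity : 0 ≤ ε / 3 + ε / 3) fun v => ?_).trans_lt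
    (by linarith)
  rw [ContinuousLinearMap.comp_apply]
  -- Symmetry moves `Q n` from the arbitrary `v` to finitely many fixed basis vectors, which makes
  -- strong convergence uniform over the unit ball.
  have h1 : ‖∑ i ∈ F, ⟪stdBasis H i, Q n v⟫_ℝ • A (stdBasis H i)‖ ≤ ε / 3 * ‖v‖ := by
    calc _ ≤ ∑ i ∈ F, ‖Q n (stdBasis H i)‖ * ‖A (stdBasis H i)‖ * ‖v‖ := by
          refine norm_sum_le_of_le _ fun i _ => ?_
          rw [norm_smul, hsymm, mul_right_comm]
          gcongr
          exact norm_inner_le_norm _ _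
      _ ≤ _ := by
          rw [← Finset.sum_mul]
          gcongr
          exact (le_abs_self _).trans hn.le
  have h2 := htail (Q n v)
  have h3 := hQ n v
  have h4 : A (Q n v) = (A (Q n v) - ∑ i ∈ F, ⟪stdBasis H i, Q n v⟫_ℝ • A (stdBasis H i)) +
    ∑ i ∈ F, ⟪stdBasis H i, Q n v⟫_ℝ • A (stdBasis H i) := by simp
  rw [h4]
  refine (norm_add_le _ _).trans ?_
  nlinarith

/-- If `Cn n → C` and the spectral projections of `Cn n` retain all eigenvalues above `α n → 0`,
then they converge to the identity, in norm after composition with a Hilbert-Schmidt operator. -/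
lemma tendsto_norm_comp_sub_spectralProj {C : H →L[ℝ] H} {lam : ℕ → ℝ} {f : ℕ → H}
    (hC : SpectralDecomposition C lam f) (hpos : ∀ j, 0 < lam j) (hinj : ∀ v, C v = 0 → v = 0)
    {Cn : ℕ → H →L[ℝ] H} {ev : ℕ → ℕ → ℝ} {e : ℕ → ℕ → H}
    (hCn : ∀ n, SpectralDecomposition (Cn n) (ev n) (e n)) (hlim : Tendsto Cn atTop (𝓝 C))
    {α : ℕ → ℝ} (hα : ∀ n, 0 < α n) (hα0 : Tendsto α atTop (𝓝 0)) {K : ℕ → ℕ}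
    (hK : ∀ n j, K n ≤ j → ev n j ≤ α n) {A : H →L[ℝ] H} (hA : IsHilbertSchmidt A) :
    Tendsto (fun n => ‖A ∘L (1 - spectralProj (e n) (K n))‖) atTop (𝓝 0) := by
  set Q : ℕ → H →L[ℝ] H := fun n => 1 - spectralProj (e n) (K n) with hQ
  have hQv (n : ℕ) (v : H) : Q n v = v - spectralProj (e n) (K n) v := rfl
  have hQ1 (n : ℕ) (v : H) : ‖Q n v‖ ≤ ‖v‖ := norm_sub_spectralProj_le (hCn n).orthonormal _ v
  refine hA.tendsto_norm_comp hQ1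
    (fun n v w => inner_sub_spectralProj_comm _ _ v w)
    (tendsto_zero_of_dense_span hQ1 (hC.dense_span hinj) ?_)
  rintro _ ⟨i, rfl⟩
  rw [tendsto_zero_iff_norm_tendsto_zero]
  -- From `lam i • Q f_i = Q C f_i = Q Cn f_i - Q (Cn - C) f_i`: the first term is at most `α n`,
  -- the second at most `‖Cn - C‖`.
  have hbound (n : ℕ) : ‖Q n (f i)‖ ≤ (lam i)⁻¹ * (‖Cn n - C‖ + α n) := by
    rw [le_inv_mul_iff₀ (hpos i)]
    have hfi : ‖f i‖ = 1 := hC.orthonormal.1 i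
    have h1 : lam i * ‖Q n (f i)‖ = ‖Q n (C (f i))‖ := by
      rw [hC.apply_eigenvector, map_smul, norm_smul, Real.norm_of_nonneg (hpos i).le]
    have h2 : Q n (C (f i)) = Q n (Cn n (f i)) - Q n ((Cn n - C) (f i)) := by simp
    rw [h1, h2]
    refine (norm_sub_le _ _).trans ?_
    have h3 : ‖Q n (Cn n (f i))‖ ≤ α n := by
      have h := (hCn n).norm_apply_sub_spectralProj_apply_le (hα n).le (hK n) (f i)
      rwa [hfi, mul_one] at h
    have h4 : ‖Q n ((Cn n - C) (f i))‖ ≤ ‖Cn n - C‖ := by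
      refine (hQ1 _ _).trans ?_
      simpa [hfi] using (Cn n - C).le_opNorm (f i)
    linarith
  refine squeeze_zero (fun _ => norm_nonneg _) hbound ?_
  have := ((tendsto_iff_norm_sub_tendsto_zero.1 hlim).add hα0).const_mul (lam i)⁻¹
  simpa using this

end SpectralProjection

/-! ### Rank-one operators in the Hilbert-Schmidt space. -/

section HilbertSchmidtTensor

variable {H : Type*} [NormedAddCommGroup H] [InnerProductSpace ℝ H] [CompleteSpace H]

/-- Parseval in the first factor. The factorization lets orthogonality of the `u_t` pass to the
tensors `u_t ⊗ z_t`. -/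
lemma inner_tensorHS (a b c d : H) :
    ⟪tensorHS a b, tensorHS c d⟫_ℝ = ⟪a, c⟫_ℝ * ⟪b, d⟫_ℝ := by
  change ⟪HilbertSchmidt.toL2 (tensorHS a b), HilbertSchmidt.toL2 (tensorHS c d)⟫_ℝ = _
  have h (i : basisIndex H) :
      ⟪HilbertSchmidt.toL2 (tensorHS a b) i, HilbertSchmidt.toL2 (tensorHS c d) i⟫_ℝ =
        ⟪a, stdBasis H i⟫_ℝ * ⟪stdBasis H i, c⟫_ℝ * ⟪b, d⟫_ℝ := by
    change ⟪tensor a b (stdBasis H i), tensor c d (stdBasis H i)⟫_ℝ = _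
    rw [tensor_apply, tensor_apply, inner_smul_left, inner_smul_right, real_inner_comm c]
    simp [mul_assoc]
  have h1 := lp.hasSum_inner (𝕜 := ℝ) (HilbertSchmidt.toL2 (tensorHS a b))
    (HilbertSchmidt.toL2 (tensorHS c d))
  simp only [h] at h1
  exact h1.unique (((stdBasis H).hasSum_inner_mul_inner a c).mul_right _)

lemma norm_tensorHS (a b : H) : ‖tensorHS a b‖ = ‖a‖ * ‖b‖ := by
  have h := inner_tensorHS a b a b
  simp only [real_inner_self_eq_norm_sq, ← mul_pow] at h
  exact (pow_left_inj₀ (norm_nonneg _) (by positivity) two_ne_zero).1 h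

lemma HilbertSchmidt.norm_toCLM_le (T : HilbertSchmidt H) : ‖T.toCLM‖ ≤ ‖T‖ := by
  refine ContinuousLinearMap.opNorm_le_bound _ (norm_nonneg T) fun v => ?_
  have hT : HasSum (fun i => ‖T.toCLM (stdBasis H i)‖ ^ 2) (‖T‖ ^ 2) := by
    have h := lp.hasSum_norm (p := 2) (by norm_num) (HilbertSchmidt.toL2 T)
    simp only [ENNReal.toReal_ofNat, Real.rpow_ofNat] at h
    exact h
  have hsum : HasSum (fun i => ⟪stdBasis H i, v⟫_ℝ • T.toCLM (stdBasis H i)) (T.toCLM v) := by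
    have := ((stdBasis H).hasSum_repr v).mapL T.toCLM
    simpa [HilbertBasis.repr_apply_apply] using this
  refine le_of_tendsto (Filter.Tendsto.norm hsum) (Eventually.of_forall fun G => ?_)
  refine (norm_sum_le _ _).trans ?_
  simp only [norm_smul]
  refine (sq_le_sq₀ (by positivity) (mul_nonneg (norm_nonneg T) (norm_nonneg v))).1 ?_
  calc _ ≤ (∑ i ∈ G, ‖⟪stdBasis H i, v⟫_ℝ‖ ^ 2) * ∑ i ∈ G, ‖T.toCLM (stdBasis H i)‖ ^ 2 :=
        Finset.sum_mul_sq_le_sq_mul_sq _ _ _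
    _ ≤ ‖v‖ ^ 2 * ‖T‖ ^ 2 := by
        gcongr
        · exact (stdBasis H).orthonormal.sum_inner_products_le v
        · exact sum_le_hasSum _ (fun _ _ => sq_nonneg _) hT
    _ = _ := by ring

/-- Transfers the Azuma bound, which needs a Hilbert norm, to the operator norm. -/
lemma norm_sum_tensor_le (s : Finset ℕ) (a b : ℕ → H) :
    ‖∑ t ∈ s, tensor (a t) (b t)‖ ≤ ‖∑ t ∈ s, tensorHS (a t) (b t)‖ := by
  have h : (∑ t ∈ s, tensorHS (a t) (b t)).toCLM = ∑ t ∈ s, tensor (a t) (b t) :=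
    map_sum (hsSubmodule H).subtype (fun t => (⟨_, isHilbertSchmidt_tensor (a t) (b t)⟩ :
      hsSubmodule H)) s
  rw [← h]
  exact HilbertSchmidt.norm_toCLM_le _

lemma continuous_tensorHS : Continuous fun p : H × H => tensorHS p.1 p.2 := by
  let L : H →ₗ[ℝ] H →ₗ[ℝ] HilbertSchmidt H := LinearMap.mk₂ ℝ tensorHS
    (fun a b c => Subtype.ext (by
      ext v; change tensor (a + b) c v = tensor a c v + tensor b c v
      simp [inner_add_left, add_smul]))
    (fun r a b => Subtype.ext (by
      ext v; change tensor (r • a) b v = r • tensor a b v; simp [inner_smul_left, mul_smul]))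
    (fun a b c => Subtype.ext (by
      ext v; change tensor a (b + c) v = tensor a b v + tensor a c v; simp))
    (fun r a b => Subtype.ext (by
      ext v; change tensor a (r • b) v = r • tensor a b v; simp [smul_comm r]))
  have hL (a b : H) : ‖L a b‖ ≤ 1 * ‖a‖ * ‖b‖ := by
    rw [one_mul]; exact (norm_tensorHS a b).le
  exact (L.mkContinuous₂ 1 hL).continuous₂

omit [CompleteSpace H] in
lemma continuous_tensor : Continuous fun p : H × H => tensor p.1 p.2 :=
  (InnerProductSpace.rankOne ℝ (E := H) (F := H)).continuous₂.comp continuous_swap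

end HilbertSchmidtTensor

/-! ### Error decomposition and almost sure behaviour of sample moments. -/

section SampleMoments

variable {H : Type*} [NormedAddCommGroup H] [InnerProductSpace ℝ H]
  {Ω : Type*} {x y z u : ℕ → Ω → H}

lemma sampleMoment_apply [CompleteSpace H] (T : ℕ) (ω : Ω) (v : H) :
    sampleMoment x z T ω v = (T : ℝ)⁻¹ • ∑ t ∈ Finset.range T, ⟪x t ω, v⟫_ℝ • z t ω := by
  simp [sampleMoment]

lemma finiteDimensional_range_sampleMoment [CompleteSpace H] (T : ℕ) (ω : Ω) :
    FiniteDimensional ℝ (sampleMoment x z T ω).range := by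
  have hle : (sampleMoment x z T ω).range ≤
      Submodule.span ℝ ((fun t => z t ω) '' (Finset.range T : Set ℕ)) := by
    rintro _ ⟨v, rfl⟩
    simp only [ContinuousLinearMap.coe_coe]
    rw [sampleMoment_apply]
    refine Submodule.smul_mem _ _ (Submodule.sum_mem _ fun t ht =>
      Submodule.smul_mem _ _ (Submodule.subset_span ⟨t, ht, rfl⟩))
  have := FiniteDimensional.span_of_finite ℝ
    ((Finset.range T).finite_toSet.image fun t => z t ω)
  exact Submodule.finiteDimensional_of_le hle

variable [CompleteSpace H]

instance (T : ℕ) (ω : Ω) : FiniteDimensional ℝ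
    ((sampleMoment x z T ω).adjoint ∘L sampleMoment x z T ω).range := by
  have := finiteDimensional_range_sampleMoment (x := x) (z := z) T ω
  have h : ((sampleMoment x z T ω).adjoint ∘L sampleMoment x z T ω).range =
      (sampleMoment x z T ω).range.map (sampleMoment x z T ω).adjoint.toLinearMap :=
    LinearMap.range_comp _ _
  rw [h]
  infer_instance

/-- The estimation error is the sum of a regularization bias and a noise term. -/
lemma estimator_sub_eq {A : H →L[ℝ] H} {ω : Ω} (hy : ∀ t, y t ω = A (x t ω) + u t ω) (T : ℕ)
    {ev : ℕ → ℝ} {e : ℕ → H} (h : SpectralDecomposition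
      ((sampleMoment x z T ω).adjoint ∘L sampleMoment x z T ω) ev e) {α : ℝ} (hα : 0 < α) :
    estimator x y z T ω ev e α - A =
      (sampleMoment u z T ω).adjoint ∘L
          (sampleMoment x z T ω ∘L regInverse ev e (numRetained ev α)) -
        A ∘L (1 - spectralProj e (numRetained ev α)) := by
  -- Its adjoint is `A Ĉ_xz* + Ĉ_uz*`. Composed with `Ĉ_xz` and the regularized inverse, the first
  -- summand becomes `A P`.
  have hyz : sampleMoment y z T ω = sampleMoment x z T ω ∘L A.adjoint + sampleMoment u z T ω := by
    ext v
    rw [add_apply, ContinuousLinearMap.comp_apply, sampleMoment_apply, sampleMoment_apply,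
      sampleMoment_apply, ← smul_add, ← Finset.sum_add_distrib]
    simp only [hy, inner_add_left, add_smul, ContinuousLinearMap.adjoint_inner_right]
  have hcomp := h.comp_regInverse (K := numRetained ev α) fun j hj =>
    hα.trans ((h.lt_numRetained_iff hα.le j).1 hj)
  rw [estimator, hyz, map_add, ContinuousLinearMap.adjoint_comp,
    ContinuousLinearMap.adjoint_adjoint, ← hcomp]
  ext v
  simp only [add_apply, sub_apply, ContinuousLinearMap.comp_apply, map_sub,
    one_apply_eq_self]
  abel

variable [TopologicalSpace.SeparableSpace H] [MeasurableSpace H] [BorelSpace H]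
  {mΩ : MeasurableSpace Ω} {μ : Measure Ω} [IsProbabilityMeasure μ]

lemma ae_tendsto_sampleMoment (hx : ∀ t, Measurable (x t)) (hz : ∀ t, Measurable (z t))
    (hst : StrictlyStationary μ fun t ω => (x t ω, z t ω))
    (hmix : GeometricallyStronglyMixing μ fun t ω => (x t ω, z t ω))
    {a b : ℝ} (ha : ∀ᵐ ω ∂μ, ∀ t, ‖x t ω‖ ≤ a) (hb : ∀ᵐ ω ∂μ, ∀ t, ‖z t ω‖ ≤ b) :
    ∀ᵐ ω ∂μ, Tendsto (fun T => sampleMoment x z T ω) atTop (𝓝 (crossMoment μ (x 0) (z 0))) := by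
  have : SecondCountableTopology H := UniformSpace.secondCountable_of_separable H
  -- The tensor map is unbounded on `H × H`; cut off to `D` it is bounded and almost surely
  -- unchanged along the process.
  set D : Set (H × H) := {p | ‖p.1‖ ≤ a ∧ ‖p.2‖ ≤ b} with hD
  have hDm : MeasurableSet D :=
    (measurable_fst.norm measurableSet_Iic).inter (measurable_snd.norm measurableSet_Iic)
  set g : H × H → H →L[ℝ] H := D.indicator fun p => tensor p.1 p.2 with hg
  have hgm : StronglyMeasurable g := continuous_tensor.stronglyMeasurable.indicator hDm
  have hgb (p : H × H) : ‖g p‖ ≤ |a| * |b| := by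
    by_cases hp : p ∈ D
    · rw [hg, Set.indicator_of_mem hp]
      refine ContinuousLinearMap.opNorm_le_bound _ (by positivity) fun v => ?_
      rw [tensor_apply, norm_smul]
      calc _ ≤ ‖p.1‖ * ‖v‖ * ‖p.2‖ := by gcongr; exact norm_inner_le_norm _ _
        _ ≤ |a| * ‖v‖ * |b| := by
          gcongr
          · exact hp.1.trans (le_abs_self a)
          · exact hp.2.trans (le_abs_self b)
        _ = _ := by ring
    · rw [hg, Set.indicator_of_notMem hp, norm_zero]; positivity
  have hw (t : ℕ) : Measurable fun ω => (x t ω, z t ω) := (hx t).prodMk (hz t)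
  have hgw : ∀ᵐ ω ∂μ, ∀ t, g (x t ω, z t ω) = tensor (x t ω) (z t ω) := by
    filter_upwards [ha, hb] with ω h1 h2 t
    have hmem : (x t ω, z t ω) ∈ D := ⟨h1 t, h2 t⟩
    rw [hg, Set.indicator_of_mem hmem]
  have hint : ∫ p, g p ∂μ.map (fun ω => (x 0 ω, z 0 ω)) = crossMoment μ (x 0) (z 0) := by
    rw [integral_map (hw 0).aemeasurable hgm.aestronglyMeasurable, crossMoment]
    refine integral_congr_ae ?_
    filter_upwards [hgw] with ω hω using hω 0
  filter_upwards [ae_tendsto_average_of_bounded hw hst hmix hgm hgb, hgw] with ω hω hω'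
  rw [hint] at hω
  simpa only [hω', sampleMoment] using hω

/-- The increments `u_t ⊗ z_t` are orthogonal to their past because `pastSigma z u t` contains `z t`
along with all earlier errors. -/
lemma ae_eventually_norm_sampleMoment_le (hz : ∀ t, Measurable (z t)) (hu : ∀ t, Measurable (u t))
    (hmds : ∀ t, μ[u t | pastSigma z u t] =ᵐ[μ] 0)
    {a b : ℝ} (ha : ∀ᵐ ω ∂μ, ∀ t, ‖u t ω‖ ≤ a) (hb : ∀ᵐ ω ∂μ, ∀ t, ‖z t ω‖ ≤ b) :
    ∃ c : ℝ, ∀ᵐ ω ∂μ, ∀ᶠ T : ℕ in atTop,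
      ‖sampleMoment u z T ω‖ ≤ c * √((T : ℝ)⁻¹ * Real.log T) := by
  have : SecondCountableTopology H := UniformSpace.secondCountable_of_separable H
  set d : ℕ → Ω → HilbertSchmidt H := fun t ω => tensorHS (u t ω) (z t ω) with hd
  have hdm (t : ℕ) : AEStronglyMeasurable (d t) μ :=
    (continuous_tensorHS.comp_stronglyMeasurable
      ((hu t).stronglyMeasurable.prodMk (hz t).stronglyMeasurable)).aestronglyMeasurable
  -- The added `1` makes the increment bound strictly positive.
  have hc : 0 < |a| * |b| + 1 := by positivity
  have hdb (t : ℕ) : ∀ᵐ ω ∂μ, ‖d t ω‖ ≤ |a| * |b| + 1 := by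
    filter_upwards [ha, hb] with ω h1 h2
    rw [hd, norm_tensorHS]
    have := mul_le_mul ((h1 t).trans (le_abs_self a)) ((h2 t).trans (le_abs_self b))
      (norm_nonneg _) (abs_nonneg a)
    linarith
  have hui (t : ℕ) : Integrable (u t) μ := by
    refine Integrable.of_bound (hu t).aestronglyMeasurable a ?_
    filter_upwards [ha] with ω hω using hω t
  have hle (t : ℕ) : pastSigma z u t ≤ mΩ :=
    sup_le (iSup₂_le fun s _ => (hz s).comap_le) (iSup₂_le fun s _ => (hu s).comap_le)
  have hzp {s t : ℕ} (hst : s ≤ t) : StronglyMeasurable[pastSigma z u t] (z s) := by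
    refine Measurable.stronglyMeasurable (Measurable.of_comap_le (le_sup_of_le_left ?_))
    exact le_iSup₂ (f := fun s (_ : s ≤ t) => MeasurableSpace.comap (z s) inferInstance) s hst
  have hup {s t : ℕ} (hst : s < t) : StronglyMeasurable[pastSigma z u t] (u s) := by
    refine Measurable.stronglyMeasurable (Measurable.of_comap_le (le_sup_of_le_right ?_))
    exact le_iSup₂ (f := fun s (_ : s < t) => MeasurableSpace.comap (u s) inferInstance) s hst
  refine ⟨2 * (|a| * |b| + 1), ?_⟩
  have hmain := ae_eventually_norm_sum_le hdm hc hdb fun t ψ hψ hi => by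
    -- Here `⟪∑ u_s ⊗ z_s, u_t ⊗ z_t⟫ = ⟪V, u_t⟫`, with `V` measurable with respect to the past, so
    -- the martingale difference property applies.
    set V : Ω → H := fun ω => ∑ s ∈ Finset.range t, ⟪z s ω, z t ω⟫_ℝ • u s ω with hV
    have hSV (ω : Ω) : ⟪∑ s ∈ Finset.range t, d s ω, d t ω⟫_ℝ *
        ψ ‖∑ s ∈ Finset.range t, d s ω‖ =
          ⟪ψ ‖∑ s ∈ Finset.range t, d s ω‖ • V ω, u t ω⟫_ℝ := by
      rw [inner_smul_left, hV, sum_inner, sum_inner]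
      simp only [hd, inner_tensorHS, inner_smul_left, conj_trivial]
      rw [mul_comm]
      simp only [mul_comm]
    have hVm : StronglyMeasurable[pastSigma z u t] V :=
      Finset.stronglyMeasurable_fun_sum _ fun s hs =>
        ((hzp (Finset.mem_range.1 hs).le).inner (hzp le_rfl)).smul (hup (Finset.mem_range.1 hs))
    have hSm : StronglyMeasurable[pastSigma z u t] fun ω => ∑ s ∈ Finset.range t, d s ω :=
      Finset.stronglyMeasurable_fun_sum _ fun s hs =>
        continuous_tensorHS.comp_stronglyMeasurable
          ((hup (Finset.mem_range.1 hs)).prodMk (hzp (Finset.mem_range.1 hs).le))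
    have hψm : StronglyMeasurable[pastSigma z u t] fun ω => ψ ‖∑ s ∈ Finset.range t, d s ω‖ :=
      (hψ.comp hSm.norm.measurable).stronglyMeasurable
    simp only [hSV] at hi ⊢
    exact integral_inner_eq_zero_of_condExp_eq_zero (hle t) (hui t) (hψm.smul hVm) hi (hmds t)
  filter_upwards [hmain] with ω hω
  filter_upwards [hω, eventually_ge_atTop 1] with T hT hT1
  have hT0 : (0 : ℝ) < T := by exact_mod_cast hT1
  have hlog : 0 ≤ Real.log T := Real.log_natCast_nonneg T
  rw [sampleMoment, norm_smul, Real.norm_of_nonneg (by positivity)]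
  have hsqrt : (T : ℝ)⁻¹ * √(T * Real.log T) = √((T : ℝ)⁻¹ * Real.log T) := by
    rw [← Real.sqrt_sq (by positivity : 0 ≤ (T : ℝ)⁻¹), ← Real.sqrt_mul (by positivity),
      Real.sqrt_sq (by positivity)]
    congr 1
    field_simp
  calc _ ≤ (T : ℝ)⁻¹ * (2 * (|a| * |b| + 1) * √(T * Real.log T)) := by
        gcongr
        exact (norm_sum_tensor_le _ _ _).trans hT
    _ = _ := by rw [← hsqrt]; ring

end SampleMoments

end FIVE

/-! ### Consistency: the noise and bias bounds combined. -/

theorem theorem1 {H : Type*} [NormedAddCommGroup H] [InnerProductSpace ℝ H] [CompleteSpace H]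
    [TopologicalSpace.SeparableSpace H] [MeasurableSpace H] [BorelSpace H]
    {Ω : Type*} [MeasurableSpace Ω] (μ : Measure Ω) [IsProbabilityMeasure μ]
    (A : H →L[ℝ] H) (x y z u : ℕ → Ω → H) (lam : ℕ → ℝ) (f : ℕ → H)
    (hmodel : FIVE.ModelAssumption μ A x y z u lam f)
    (hstrong : FIVE.StrongAssumption μ x z u)
    -- any eigenvalues and eigenfunctions of the sample operator `Ĉ_xz* Ĉ_xz`
    (ev : ℕ → Ω → ℕ → ℝ) (e : ℕ → Ω → ℕ → H)
    (hspec : ∀ T ω, FIVE.SpectralDecomposition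
      ((FIVE.sampleMoment x z T ω).adjoint ∘L FIVE.sampleMoment x z T ω) (ev T ω) (e T ω))
    -- the regularization parameter
    (α : ℕ → ℝ) (hα : ∀ T, 0 < α T) (hα0 : Tendsto α atTop (𝓝 0))
    (hτ : ∀ᵐ ω ∂μ,
      (fun T : ℕ => ∑ j ∈ Finset.range (FIVE.numRetained (ev T ω) (α T)), FIVE.gapWeight lam j)
        =o[atTop] fun T : ℕ => (T : ℝ) ^ (1 / 2 : ℝ) * Real.log T ^ (-(3 / 2) : ℝ))
    (hαT : Tendsto (fun T : ℕ => (α T)⁻¹ * (T : ℝ)⁻¹ * Real.log T) atTop (𝓝 0)) :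
    ∀ᵐ ω ∂μ, Tendsto
      (fun T : ℕ => ‖FIVE.estimator x y z T ω (ev T ω) (e T ω) (α T) - A‖) atTop (𝓝 0) := by
  obtain ⟨a, ha⟩ := hstrong.bounded_x
  obtain ⟨b, hb⟩ := hstrong.bounded_z
  obtain ⟨m, hm⟩ := hstrong.bounded_u
  obtain ⟨c, hc⟩ := FIVE.ae_eventually_norm_sampleMoment_le hmodel.measurable_z hmodel.measurable_u
    hmodel.martingale_diff hm hb
  filter_upwards [hc, ae_all_iff.2 hmodel.model,
    FIVE.ae_tendsto_sampleMoment hmodel.measurable_x hmodel.measurable_z hmodel.stationary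
      hmodel.mixing ha hb] with ω hnoise hy hlim
  have hlim' : Tendsto
      (fun T => (FIVE.sampleMoment x z T ω).adjoint ∘L FIVE.sampleMoment x z T ω) atTop
      (𝓝 ((FIVE.crossMoment μ (x 0) (z 0)).adjoint ∘L FIVE.crossMoment μ (x 0) (z 0))) :=
    ((ContinuousLinearMap.compL ℝ H H H).continuous₂.tendsto _).comp
      (((ContinuousLinearMap.adjoint.continuous.tendsto _).comp hlim).prodMk_nhds hlim)
  have hbias := FIVE.tendsto_norm_comp_sub_spectralProj hmodel.spectral hmodel.pos
    hmodel.identified (fun T => hspec T ω) hlim' hα hα0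
    (K := fun T => FIVE.numRetained (ev T ω) (α T))
    (fun T j hj => not_lt.1 fun h =>
      absurd (((hspec T ω).lt_numRetained_iff (hα T).le j).2 h) (not_lt.2 hj))
    hmodel.hilbertSchmidt
  have hrate := ((Real.continuous_sqrt.tendsto 0).comp hαT).const_mul c
  rw [Real.sqrt_zero, mul_zero] at hrate
  have hsum := hrate.add hbias
  rw [add_zero] at hsum
  refine squeeze_zero' (Eventually.of_forall fun _ => norm_nonneg _) ?_ hsum
  filter_upwards [hnoise] with T hT
  rw [FIVE.estimator_sub_eq hy T (hspec T ω) (hα T)]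
  refine (norm_sub_le _ _).trans (add_le_add_left ?_ _)
  refine (ContinuousLinearMap.opNorm_comp_le _ _).trans ?_
  rw [LinearIsometryEquiv.norm_map]
  -- The two square roots multiply to `√(α⁻¹ T⁻¹ log T)`, the quantity assumed to vanish.
  calc _ ≤ c * √((T : ℝ)⁻¹ * Real.log T) * √((α T)⁻¹) :=
        mul_le_mul hT (FIVE.norm_comp_regInverse_le (hspec T ω) (hα T)
          fun j hj => ((hspec T ω).lt_numRetained_iff (hα T).le j).1 hj) (norm_nonneg _)
          ((norm_nonneg _).trans hT)
    _ = _ := by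
        rw [mul_assoc, ← Real.sqrt_mul' _ (inv_nonneg.2 (hα T).le), Function.comp_apply]
        congr 2
        ring
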